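/- **Setting.** Let $\mathcal D$ be a probability distribution of examples $(x,y)\in\mathbb R^d\times\mathcal Y$ with $\|x\|\le 1$ almost surely (Euclidean norm), and let $\ell:\mathbb R\times\mathcal Y\to[0,\infty)$ be a measurable loss such that for every $y$ the function $\ell(\cdot,y)$ is convex, differentiable and $\beta$-smooth: $\ell(a,y)\le \ell(b,y)+\ell'(b,y)(a-b)+\frac\beta2(a-b)^2$ for all $a,b\in\mathbb R$, where $'$ is the derivative in the first argument. Let $R>0$ and $\mathcal H=\{w\in\mathbb R^d:\|w\|\le R\}$, let $\mathcal L(w)=\mathbb E_{(x,y)\sim\mathcal D}[\ell(\langle w,x\rangle,y)]$ be finite on $\mathcal H$ and $\alpha$-strongly convex on $\mathcal H$, with $\alpha,\beta>0$, and let $\epsilon_{\rm opt}=\min_{w\in\mathcal H}\mathcal L(w)$. Let $\epsilon_{\rm prior}>0$ satisfy $\epsilon_{\rm prior}\ge\epsilon_{\rm opt}$. **Algorithm.** Inputs are $m\ge1$, $T_1\ge 1$, $\eta>0$, $\xi\ge1$, $\varepsilon,\tau\in(0,1)$ and $\epsilon_{\rm prior}$. Put $\widehat w_1=0$ and $\Delta_1=R$.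 In stage $k=1,\dots,m$ let $\mathcal H_k=\{w\in\mathcal H:\|w-\widehat w_k\|\le\Delta_k\}$, $\gamma_k=2\xi\beta\Delta_k$, $w_k^1=\widehat w_k$. For $t=1,\dots,T_1$ take a fresh example $(x_k^t,y_k^t)$, let $\hat g_k^t=\ell'(\langle w_k^t,x_k^t\rangle,y_k^t)\,x_k^t$, let $v_k^t$ have coordinates $[v_k^t]_i=\operatorname{sign}([\hat g_k^t]_i)\min(\gamma_k,|[\hat g_k^t]_i|)$, and let $w_k^{t+1}=\Pi_{\mathcal H_k}(w_k^t-\eta v_k^t)$, where $\Pi$ is Euclidean projection. Then put $$\widehat w_{k+1}=\frac1{T_1}\sum_{t=1}^{T_1}w_k^t,\qquad \Delta_{k+1}^2=\varepsilon\Delta_k^2+\frac{2\tau}{\beta}\,\epsilon_{\rm prior}.$$ The algorithm uses $T=mT_1$ i.i.d. examples from $\mathcal D$ in all. **Theorem (convergence rate).** Let $\varepsilon,\tau,\delta\in(0,1)$ and $m\ge 1$, and set $$\xi=\frac{4\beta}{\alpha\tau},\qquad T_1=\left\lceil 4\max\left\{\frac{\xi^3\beta d+2\xi\beta\sqrt d}{\varepsilon\alpha}\ln\frac{ms}{\delta},\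 \frac{16\xi^2\beta^2}{\alpha^2\varepsilon^2}\right\}\right\rceil,\qquad \eta=\frac1{2\xi\beta\sqrt{T_1}},$$ where $s=\max\{1,\lceil\log_2(\xi\beta R^2/\epsilon_{\rm prior})\rceil\}$. Then after $m$ stages, with probability at least $1-\delta$, $$\mathcal L(\widehat w_{m+1})\le\frac{\beta R^2}2\,\varepsilon^m+\Big(1+\frac\tau{1-\varepsilon}\Big)\epsilon_{\rm prior}.$$ Consequently $O(d\log(1/\epsilon_{\rm prior}))$ examples, up to the factor $\log(\log(1/\epsilon_{\rm prior})/\delta)$, suffice for risk $O(\epsilon_{\rm prior})$. Precisely, there is a constant $C>0$ depending only on $\alpha,\beta,R,\varepsilon,\tau$ such that for all $d\ge1$, $\epsilon_{\rm prior}\in(0,1/16]$ and $\delta\in(0,1)$ there is $m\ge1$ for which $$T=mT_1\le C\,d\,\log\frac1{\epsilon_{\rm prior}}\,\log\frac{\log(1/\epsilon_{\rm prior})}{\delta},$$ and, for every distribution and loss as above, the algorithm run with these parameters satisfies, with probability at least $1-\delta$, $\mathcal L(\widehat w_{m+1})\le\big(1+\frac\tau{1-\varepsilon}+\frac{\beta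 R^2}2\big)\epsilon_{\rm prior}$. -/

import Mathlib

open MeasureTheory ProbabilityTheory

namespace TargetRisk

noncomputable section

/-- Instances and weight vectors live in `ℝ^d` with the Euclidean norm. -/
abbrev Vec (d : ℕ) : Type := EuclideanSpace ℝ (Fin d)

/-- The hypothesis class: linear predictors with weight vector of norm at most `R`. -/
def hypotheses (d : ℕ) (R : ℝ) : Set (Vec d) := {w | ‖w‖ ≤ R}

/-- The expected loss (risk) of the linear predictor `w`. -/
def risk {d : ℕ} {Y : Type*} [MeasurableSpace Y] (D : Measure (Vec d × Y)) (loss : ℝ → Y → ℝ)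
    (w : Vec d) : ℝ :=
  ∫ z, loss (inner ℝ w z.1) z.2 ∂D

/-- The optimal risk over the hypothesis class. -/
def optRisk {d : ℕ} {Y : Type*} [MeasurableSpace Y] (D : Measure (Vec d × Y))
    (loss : ℝ → Y → ℝ) (R : ℝ) : ℝ :=
  sInf (risk D loss '' hypotheses d R)

/-- A differentiable function on the line is `β`-smooth. -/
def IsSmooth (β : ℝ) (f : ℝ → ℝ) : Prop :=
  Differentiable ℝ f ∧ ∀ a b : ℝ, f a ≤ f b + deriv f b * (a - b) + β / 2 * (a - b) ^ 2

/-- The learning setting: examples `(x, y)` are drawn from a probability distribution with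
`‖x‖ ≤ 1`; every loss function `loss · y` is nonnegative, convex and `β`-smooth; the risk is finite
and `α`-strongly convex on the hypothesis class. -/
structure Setting {d : ℕ} {Y : Type*} [MeasurableSpace Y] (D : Measure (Vec d × Y))
    (loss : ℝ → Y → ℝ) (α β R : ℝ) : Prop where
  isProbability : IsProbabilityMeasure D
  norm_le_one : ∀ᵐ z ∂D, ‖z.1‖ ≤ 1
  measurable_loss : Measurable (Function.uncurry loss)
  loss_nonneg : ∀ a y, 0 ≤ loss a y
  loss_convex : ∀ y, ConvexOn ℝ Set.univ (fun a => loss a y)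
  loss_smooth : ∀ y, IsSmooth β (fun a => loss a y)
  integrable_loss : ∀ w ∈ hypotheses d R, Integrable (fun z => loss (inner ℝ w z.1) z.2) D
  risk_strongConvex : StrongConvexOn (hypotheses d R) α (risk D loss)

/-- Clipping of a real number at level `γ`. -/
def clip (γ a : ℝ) : ℝ := Real.sign a * min γ |a|

/-- Coordinatewise clipping of a vector at level `γ`. -/
def clipVec {d : ℕ} (γ : ℝ) (g : Vec d) : Vec d := WithLp.toLp 2 (fun i => clip γ (g i))

/-- The Euclidean projection onto `K`: a point of `K` nearest to `w` (it exists and is unique when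
`K` is nonempty, closed and convex). -/
def proj {d : ℕ} (K : Set (Vec d)) (w : Vec d) : Vec d :=
  Classical.epsilon (fun p => p ∈ K ∧ ∀ q ∈ K, ‖w - p‖ ≤ ‖w - q‖)

/-- The stochastic gradient at `w` computed from the example `z = (x, y)`. -/
def stochGrad {d : ℕ} {Y : Type*} (loss : ℝ → Y → ℝ) (w : Vec d) (z : Vec d × Y) : Vec d :=
  deriv (fun a => loss a z.2) (inner ℝ w z.1) • z.1

/-- The input of the algorithm: domain radius `R`, smoothness `β`, clipping parameter `ξ`, step size
`η`, stage size `T₁`, target risk, and the two parameters `ε`, `τ` of the domain update. -/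
structure Params where
  R : ℝ
  β : ℝ
  ξ : ℝ
  η : ℝ
  T₁ : ℕ
  εprior : ℝ
  ε : ℝ
  τ : ℝ

/-- The domain sizes. Stages are numbered from `0`, so `domainSize p k` is `Δ_{k+1}`. -/
def domainSize (p : Params) : ℕ → ℝ
  | 0 => p.R
  | k + 1 => Real.sqrt (p.ε * domainSize p k ^ 2 + 2 * p.τ / p.β * p.εprior)

/-- The shrunken domain around the centre `c`. -/
def domain {d : ℕ} (R Δ : ℝ) (c : Vec d) : Set (Vec d) := {w ∈ hypotheses d R | ‖w - c‖ ≤ Δ}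

/-- The iterates of one stage with initial point `c`, domain size `Δ` and examples
`S 0, S 1, …`: projected stochastic gradient descent with gradients clipped at `2 ξ β Δ`. -/
def stageIterate {d : ℕ} {Y : Type*} (p : Params) (loss : ℝ → Y → ℝ) (c : Vec d) (Δ : ℝ)
    (S : ℕ → Vec d × Y) : ℕ → Vec d
  | 0 => c
  | t + 1 =>
    let w := stageIterate p loss c Δ S t
    proj (domain p.R Δ c) (w - p.η • clipVec (2 * p.ξ * p.β * Δ) (stochGrad loss w (S t)))

/-- The average of the `T₁` iterates of a stage. -/
def stageAverage {d : ℕ} {Y : Type*} (p : Params) (loss : ℝ → Y → ℝ) (c : Vec d) (Δ : ℝ)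
    (S : ℕ → Vec d × Y) : Vec d :=
  (1 / (p.T₁ : ℝ)) • ∑ t ∈ Finset.range p.T₁, stageIterate p loss c Δ S t

/-- The solution held by the algorithm after `m` stages, run on the stream of examples `S`. Stage
`k = 0, 1, …` consumes the `T₁` examples `S (k T₁), …, S (k T₁ + T₁ - 1)`, so that `output p loss S m`
depends on the first `m T₁` examples only. -/
def output {d : ℕ} {Y : Type*} (p : Params) (loss : ℝ → Y → ℝ) (S : ℕ → Vec d × Y) :
    ℕ → Vec d
  | 0 => 0
  | k + 1 => stageAverage p loss (output p loss S k) (domainSize p k) (fun t => S (k * p.T₁ + t))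

/-- `ξ = 4β / (ατ)`. -/
def xi (α β τ : ℝ) : ℝ := 4 * β / (α * τ)

/-- `s = ⌈log₂ (ξ β R² / εprior)⌉`, read as `1` when that number is not positive. -/
def peels (α β R τ εprior : ℝ) : ℕ := max 1 ⌈Real.logb 2 (xi α β τ * β * R ^ 2 / εprior)⌉₊

/-- The stage size `T₁`, rounded up to an integer. -/
def stageSize (d m : ℕ) (α β R ε τ εprior δ : ℝ) : ℕ :=
  ⌈4 * max
    ((xi α β τ ^ 3 * β * d + 2 * xi α β τ * β * Real.sqrt d) / (ε * α)
      * Real.log (m * peels α β R τ εprior / δ))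
    (16 * xi α β τ ^ 2 * β ^ 2 / (α ^ 2 * ε ^ 2))⌉₊

/-- The parameters prescribed for `m` stages in dimension `d` at confidence `1 - δ`; the step size is
`η = 1 / (2 ξ β √T₁)`. -/
def params (d m : ℕ) (α β R ε τ εprior δ : ℝ) : Params where
  R := R
  β := β
  ξ := xi α β τ
  η := 1 / (2 * xi α β τ * β * Real.sqrt (stageSize d m α β R ε τ εprior δ))
  T₁ := stageSize d m α β R ε τ εprior δ
  εprior := εprior
  ε := ε
  τ := τ

/-- `Z 0, Z 1, …` is an i.i.d. sequence of examples with distribution `D`. -/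
structure IsIIDSample {Ω : Type*} [MeasurableSpace Ω] {d : ℕ} {Y : Type*} [MeasurableSpace Y]
    (P : Measure Ω) (D : Measure (Vec d × Y)) (Z : ℕ → Ω → Vec d × Y) : Prop where
  measurable : ∀ i, Measurable (Z i)
  indep : iIndepFun Z P
  law : ∀ i, P.map (Z i) = D

end

end TargetRisk

/-!
Fix a minimiser `w₀` of the risk `L` over the hypothesis class. The invariant is that stage `k` starts
within distance `Δ_k` of `w₀`. If the stage ends with `L(ŵ) - L(w₀) ≤ α Δ_{k+1}² / 2`, then strong
convexity restores the invariant, and at the last stage, as `α ≤ β` (`Setting.alpha_le_beta`), this is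
the asserted bound after unrolling the recursion for `Δ_k²`.

Within a stage let `v_t` be the clipped gradient. Projected descent gives the deterministic regret
bound `∑ Y_t ≤ Δ² / (2η)` for the progress `Y_t = ⟨v_t, w_t - w₀⟩ - η ‖v_t‖² / 2`
(`sum_progress_le`). Nonnegative smooth losses are self-bounding, `‖g‖² ≤ 2 β ℓ`, so that three error
terms are small multiples of the loss itself: the clipping bias, at most `ℓ / (2ξ)`; the step cost
`η ‖v‖² / 2`; and the second-order term of the exponential moment of `Y_t`. Hence, pointwise in the
example,
`exp (-λ Y) ≤ 1 + λ (ℓ(w₀) - (1 - 2/ξ) ℓ(w))` (`exp_neg_progress_le`),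
and taking expectations shows that `exp (λ ((1 - 2/ξ) L(w) - L(w₀) - Y))` has mean at most one
(`lintegral_weight_le_one`). The product of these weights along the stage is a supermartingale, and
Markov's inequality bounds its probability of exceeding `exp u` by `exp (-u)`
(`measure_excess_le`). For `λ` proportional to `u / (α ε Δ² T₁)` with `u = log (m s / δ)`, both the
regret and the confidence term `u / λ` are at most `α ε Δ² T₁ / 8`, and the discount `2/ξ` produces
the term with `εprior` (`risk_stageAverage_sub_le`). As the variance is measured by the loss with a
deterministic `λ`, no peeling over the size of the variance takes place; the factor `s ≥ 1` in the
confidence level is slack.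

For the sample complexity (`exists_stages_mul_stageSize_le`), `m` is the number of stages that brings
`ε ^ m` below `εprior`.
-/

open scoped ENNReal

namespace TargetRisk

/-! ### Clipping and smooth losses -/

section

theorem abs_clip_le_abs {γ : ℝ} (hγ : 0 ≤ γ) (a : ℝ) : |clip γ a| ≤ |a| := by
  unfold clip
  rcases lt_trichotomy a 0 with h | h | h
  · rw [Real.sign_of_neg h, neg_one_mul, abs_neg, abs_of_nonneg (le_min hγ (abs_nonneg a))]
    exact min_le_right _ _
  · simp [h]
  · rw [Real.sign_of_pos h, one_mul, abs_of_nonneg (le_min hγ (abs_nonneg a))]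
    exact min_le_right _ _

theorem abs_clip_le {γ : ℝ} (hγ : 0 ≤ γ) (a : ℝ) : |clip γ a| ≤ γ := by
  unfold clip
  rcases lt_trichotomy a 0 with h | h | h
  · rw [Real.sign_of_neg h, neg_one_mul, abs_neg, abs_of_nonneg (le_min hγ (abs_nonneg a))]
    exact min_le_left _ _
  · simp [h, hγ]
  · rw [Real.sign_of_pos h, one_mul, abs_of_nonneg (le_min hγ (abs_nonneg a))]
    exact min_le_left _ _

/-- The error of clipping is quadratic: `|a| - γ ≤ a² / (4γ)` by the inequality of means. -/
theorem abs_sub_clip_le {γ : ℝ} (hγ : 0 < γ) (a : ℝ) : |a - clip γ a| ≤ a ^ 2 / (4 * γ) := by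
  have key : |a - clip γ a| = |a| - min γ |a| := by
    have h0 : 0 ≤ |a| - min γ |a| := sub_nonneg.2 (min_le_right _ _)
    unfold clip
    rcases lt_trichotomy a 0 with h | h | h
    · rw [Real.sign_of_neg h, ← abs_neg, ← abs_of_nonneg h0]
      congr 1
      rw [abs_of_neg h]; ring
    · simp [h, hγ.le]
    · rw [Real.sign_of_pos h, ← abs_of_nonneg h0]
      congr 1
      rw [abs_of_pos h]; ring
  rw [key, le_div_iff₀ (by positivity), ← sq_abs a]
  rcases le_total γ |a| with h | h
  · rw [min_eq_left h]; nlinarith [sq_nonneg (|a| - 2 * γ)]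
  · rw [min_eq_right h]; simpa using sq_nonneg |a|

variable {d : ℕ}

theorem norm_clipVec_le {γ : ℝ} (hγ : 0 ≤ γ) (g : Vec d) : ‖clipVec γ g‖ ≤ ‖g‖ := by
  rw [EuclideanSpace.norm_eq, EuclideanSpace.norm_eq]
  refine Real.sqrt_le_sqrt (Finset.sum_le_sum fun i _ => ?_)
  exact pow_le_pow_left₀ (norm_nonneg _) (abs_clip_le_abs hγ (g i)) 2

theorem norm_clipVec_le_sqrt {γ : ℝ} (hγ : 0 ≤ γ) (g : Vec d) :
    ‖clipVec γ g‖ ≤ Real.sqrt d * γ := by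
  rw [EuclideanSpace.norm_eq]
  refine Real.sqrt_le_iff.2 ⟨by positivity, ?_⟩
  rw [mul_pow, Real.sq_sqrt (Nat.cast_nonneg d)]
  calc ∑ i, ‖clipVec γ g i‖ ^ 2 ≤ ∑ _i : Fin d, γ ^ 2 :=
        Finset.sum_le_sum fun i _ => pow_le_pow_left₀ (norm_nonneg _) (abs_clip_le hγ (g i)) 2
    _ = d * γ ^ 2 := by simp

theorem inner_sub_clipVec_le {γ : ℝ} (hγ : 0 < γ) (g h : Vec d) :
    inner ℝ (g - clipVec γ g) h ≤ ‖g‖ ^ 2 / (4 * γ) * ‖h‖ := by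
  rw [EuclideanSpace.real_norm_sq_eq g, Finset.sum_div, Finset.sum_mul, PiLp.inner_apply]
  refine Finset.sum_le_sum fun i _ => ?_
  calc inner ℝ ((g - clipVec γ g) i) (h i) ≤ |g i - clip γ (g i)| * ‖h i‖ := by
        refine (real_inner_le_norm _ _).trans (le_of_eq ?_)
        rfl
    _ ≤ g i ^ 2 / (4 * γ) * ‖h‖ := by
        gcongr
        · exact abs_sub_clip_le hγ _
        · exact PiLp.norm_apply_le h i

/-- A nonnegative smooth function is self-bounding: compare `f` at `b` with its value at the
gradient step `b - f' b / β`. -/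
theorem IsSmooth.sq_deriv_le {β : ℝ} (hβ : 0 < β) {f : ℝ → ℝ} (hf : IsSmooth β f)
    (h0 : ∀ a, 0 ≤ f a) (b : ℝ) : deriv f b ^ 2 ≤ 2 * β * f b := by
  have h1 := hf.2 (b - deriv f b / β) b
  have h2 := h0 (b - deriv f b / β)
  have h3 : deriv f b * (b - deriv f b / β - b) + β / 2 * (b - deriv f b / β - b) ^ 2
      = - (deriv f b ^ 2 / (2 * β)) := by field_simp; ring
  have h4 : deriv f b ^ 2 / (2 * β) ≤ f b := by linarith
  rw [div_le_iff₀ (by positivity)] at h4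
  linarith

theorem sub_le_deriv_mul {f : ℝ → ℝ} (hc : ConvexOn ℝ Set.univ f) (hd : Differentiable ℝ f)
    (a b : ℝ) : f a - f b ≤ deriv f a * (a - b) := by
  rcases lt_trichotomy a b with h | h | h
  · have := hc.deriv_le_slope (Set.mem_univ a) (Set.mem_univ b) h (hd a)
    rw [slope_def_field, le_div_iff₀ (by linarith)] at this
    linarith
  · simp [h]
  · have := hc.slope_le_deriv (Set.mem_univ b) (Set.mem_univ a) h (hd a)
    rw [slope_def_field, div_le_iff₀ (by linarith)] at this
    linarith

/-- One step of the exponential-moment argument for real numbers: `X` is the linearised progress,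
`q` the quadratic cost of the step, `l` and `l'` the losses at the iterate and at the comparator. -/
theorem exp_progress_le {X q l l' lam ξ : ℝ} (hl : 0 ≤ l) (hlam : 0 < lam) (hξ : 4 ≤ ξ)
    (hq0 : 0 ≤ q) (hlX : lam * |X| ≤ 4 / 9) (hlX2 : lam * X ^ 2 ≤ 8 / (9 * ξ) * l)
    (hql : q ≤ l / (64 * ξ)) (hlq : lam * q ≤ 1 / 256)
    (hconv : l - l' ≤ X + l / (2 * ξ)) :
    Real.exp (-(lam * (X - q))) ≤ 1 + lam * (l' - (1 - 2 / ξ) * l) := by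
  have hξ0 : 0 < ξ := by linarith
  have habs : |-(lam * (X - q))| ≤ 1 := by
    rw [abs_neg, abs_mul, abs_of_pos hlam]
    have h1 : |X - q| ≤ |X| + q := by
      simpa [abs_of_nonneg hq0] using abs_sub X q
    nlinarith [mul_le_mul_of_nonneg_left h1 hlam.le]
  have h1 := (abs_le.1 (Real.abs_exp_sub_one_sub_id_le habs)).2
  set p := l / ξ with hp
  have hp0 : 0 ≤ p := by positivity
  have e1 : 8 / (9 * ξ) * l = 8 / 9 * p := by rw [hp]; field_simp
  have e2 : l / (64 * ξ) = p / 64 := by rw [hp]; field_simp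
  have e3 : l / (2 * ξ) = p / 2 := by rw [hp]; field_simp
  have e4 : (1 - 2 / ξ) * l = l - 2 * p := by rw [hp]; field_simp
  rw [e1] at hlX2
  rw [e2] at hql
  rw [e3] at hconv
  rw [e4]
  have h2 : (X - q) ^ 2 ≤ 9 / 8 * X ^ 2 + 9 * q ^ 2 := by nlinarith [sq_nonneg (X + 8 * q)]
  have h3 : lam * q ^ 2 ≤ q / 256 := by nlinarith
  have h4 : lam * (X - q) ^ 2 ≤ p + 9 * (q / 256) := by
    nlinarith [mul_le_mul_of_nonneg_left h2 hlam.le]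
  have h5 : (-(lam * (X - q))) ^ 2 = lam * (lam * (X - q) ^ 2) := by ring
  have h6 : lam * (lam * (X - q) ^ 2) ≤ lam * (p + 9 * (q / 256)) :=
    mul_le_mul_of_nonneg_left h4 hlam.le
  have h7 : lam * (-(X - q) + (p + 9 * (q / 256))) ≤ lam * (l' - (l - 2 * p)) :=
    mul_le_mul_of_nonneg_left (by linarith) hlam.le
  rw [h5] at h1
  linarith

end

/-! ### Projection onto the shrunken domain -/

section

variable {d : ℕ}

theorem convex_hypotheses (R : ℝ) : Convex ℝ (hypotheses d R) := by
  have : hypotheses d R = Metric.closedBall 0 R := by ext w; simp [hypotheses]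
  rw [this]; exact convex_closedBall 0 R

theorem isCompact_hypotheses (R : ℝ) : IsCompact (hypotheses d R) := by
  have : hypotheses d R = Metric.closedBall 0 R := by ext w; simp [hypotheses]
  rw [this]; exact isCompact_closedBall 0 R

theorem zero_mem_hypotheses {R : ℝ} (hR : 0 ≤ R) : (0 : Vec d) ∈ hypotheses d R := by
  simpa [hypotheses] using hR

theorem domain_eq (R Δ : ℝ) (c : Vec d) :
    domain R Δ c = hypotheses d R ∩ Metric.closedBall c Δ := by
  ext w; simp [domain, dist_eq_norm]

theorem convex_domain (R Δ : ℝ) (c : Vec d) : Convex ℝ (domain R Δ c) := by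
  rw [domain_eq]; exact (convex_hypotheses R).inter (convex_closedBall c Δ)

theorem isComplete_domain (R Δ : ℝ) (c : Vec d) : IsComplete (domain R Δ c) := by
  rw [domain_eq]
  exact ((isCompact_hypotheses R).isClosed.inter Metric.isClosed_closedBall).isComplete

theorem center_mem_domain {R Δ : ℝ} (hΔ : 0 ≤ Δ) {c : Vec d} (hc : c ∈ hypotheses d R) :
    c ∈ domain R Δ c := ⟨hc, by simpa using hΔ⟩

theorem proj_spec {K : Set (Vec d)} (hne : K.Nonempty) (hK : IsComplete K) (hconv : Convex ℝ K)
    (w : Vec d) : proj K w ∈ K ∧ ∀ q ∈ K, ‖w - proj K w‖ ≤ ‖w - q‖ := by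
  refine Classical.epsilon_spec (p := fun p => p ∈ K ∧ ∀ q ∈ K, ‖w - p‖ ≤ ‖w - q‖) ?_
  obtain ⟨v, hv, h⟩ := exists_norm_eq_iInf_of_complete_convex hne hK hconv w
  refine ⟨v, hv, fun q hq => ?_⟩
  rw [h]
  exact ciInf_le ⟨0, by rintro _ ⟨x, rfl⟩; exact norm_nonneg _⟩ (⟨q, hq⟩ : K)

theorem inner_sub_proj_le_zero {K : Set (Vec d)} (hne : K.Nonempty) (hK : IsComplete K)
    (hconv : Convex ℝ K) (w : Vec d) {q : Vec d} (hq : q ∈ K) :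
    inner ℝ (w - proj K w) (q - proj K w) ≤ 0 := by
  obtain ⟨h1, h2⟩ := proj_spec hne hK hconv w
  refine (norm_eq_iInf_iff_real_inner_le_zero hconv h1).1 (le_antisymm ?_ ?_) q hq
  · have : Nonempty K := hne.to_subtype
    exact le_ciInf fun x => h2 x x.2
  · exact ciInf_le ⟨0, by rintro _ ⟨x, rfl⟩; exact norm_nonneg _⟩ (⟨_, h1⟩ : K)

theorem norm_proj_sub_le {K : Set (Vec d)} (hne : K.Nonempty) (hK : IsComplete K)
    (hconv : Convex ℝ K) (w : Vec d) {q : Vec d} (hq : q ∈ K) :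
    ‖proj K w - q‖ ≤ ‖w - q‖ := by
  have h := inner_sub_proj_le_zero hne hK hconv w hq
  have h1 : ‖w - q‖ ^ 2 = ‖w - proj K w‖ ^ 2 - 2 * inner ℝ (w - proj K w) (q - proj K w)
      + ‖proj K w - q‖ ^ 2 := by
    rw [norm_sub_rev (proj K w) q, ← norm_sub_sq_real]
    congr 2; abel
  refine (sq_le_sq₀ (norm_nonneg _) (norm_nonneg _)).1 ?_
  nlinarith [sq_nonneg ‖w - proj K w‖]

theorem proj_domain_mem {R Δ : ℝ} (hΔ : 0 ≤ Δ) {c : Vec d} (hc : c ∈ hypotheses d R) (w : Vec d) :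
    proj (domain R Δ c) w ∈ domain R Δ c :=
  (proj_spec ⟨c, center_mem_domain hΔ hc⟩ (isComplete_domain R Δ c) (convex_domain R Δ c) w).1

/-- Moving a point of the domain around `c` towards `c'` by the fraction `‖c - c'‖ / (Δ + ‖c - c'‖)`
brings it into the domain around `c'`. This gives an approximate variational inequality. -/
theorem inner_sub_proj_domain_le {R Δ : ℝ} (hΔ : 0 < Δ) {c c' : Vec d}
    (hc : c ∈ hypotheses d R) (hc' : c' ∈ hypotheses d R) (w' : Vec d) {p : Vec d}
    (hp : p ∈ domain R Δ c) :
    inner ℝ (w' - proj (domain R Δ c') w') (p - proj (domain R Δ c') w')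
      ≤ ‖c - c'‖ / Δ * ((‖w'‖ + R) * (2 * R)) := by
  set p' := proj (domain R Δ c') w' with hp'
  have hR : 0 ≤ R := (norm_nonneg c).trans hc
  have hpc : p' ∈ domain R Δ c' := proj_domain_mem hΔ.le hc' w'
  set r := ‖c - c'‖ with hr
  have hr0 : 0 ≤ r := norm_nonneg _
  set t := r / (Δ + r) with ht
  have ht0 : 0 ≤ t := by positivity
  have ht1 : t ≤ 1 := by rw [ht, div_le_one (by positivity)]; linarith
  have htr : t ≤ r / Δ := by rw [ht]; gcongr; linarith
  have hq : (1 - t) • p + t • c' ∈ domain R Δ c' := by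
    refine ⟨convex_hypotheses R hp.1 hc' (by linarith) ht0 (by ring), ?_⟩
    have e : (1 - t) • p + t • c' - c' = (1 - t) • ((p - c) + (c - c')) := by module
    rw [e, norm_smul, Real.norm_of_nonneg (by linarith)]
    calc (1 - t) * ‖(p - c) + (c - c')‖ ≤ (1 - t) * (Δ + r) := by
          refine mul_le_mul_of_nonneg_left ((norm_add_le _ _).trans ?_) (by linarith)
          exact add_le_add hp.2 le_rfl
      _ = Δ := by rw [ht]; field_simp; ring
  have h := inner_sub_proj_le_zero ⟨c', center_mem_domain hΔ.le hc'⟩ (isComplete_domain R Δ c')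
    (convex_domain R Δ c') w' hq
  rw [← hp'] at h
  have e : (1 - t) • p + t • c' - p' = (p - p') + t • (c' - p) := by module
  rw [e, inner_add_right, inner_smul_right] at h
  have h1 : -inner ℝ (w' - p') (c' - p) ≤ (‖w'‖ + R) * (2 * R) := by
    refine (neg_le_abs _).trans ((abs_real_inner_le_norm _ _).trans ?_)
    have a1 : ‖w' - p'‖ ≤ ‖w'‖ + R := (norm_sub_le _ _).trans (add_le_add le_rfl hpc.1)
    have a2 : ‖c' - p‖ ≤ 2 * R := by
      refine (norm_sub_le _ _).trans ?_
      have b1 : ‖c'‖ ≤ R := hc'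
      have b2 : ‖p‖ ≤ R := hp.1
      linarith
    gcongr
  have h2 : 0 ≤ (‖w'‖ + R) * (2 * R) := by positivity
  nlinarith [mul_le_mul_of_nonneg_left h1 ht0, mul_le_mul_of_nonneg_right htr h2]

/-- The projection depends continuously on the centre of the domain too. This makes the iterates
measurable, since the centre of a stage is random. -/
theorem continuous_proj_domain {R Δ : ℝ} (hΔ : 0 < Δ) :
    Continuous fun p : hypotheses d R × Vec d => proj (domain R Δ (p.1 : Vec d)) p.2 := by
  rw [continuous_iff_continuousAt]
  rintro ⟨c, w⟩
  set P : hypotheses d R × Vec d → Vec d := fun p => proj (domain R Δ (p.1 : Vec d)) p.2 with hP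
  have key : ∀ x : hypotheses d R × Vec d, ‖P x - P (c, w)‖ ^ 2 ≤
      ‖w - x.2‖ * (2 * R) + ‖(x.1 : Vec d) - c‖ / Δ * ((‖w‖ + R) * (2 * R))
        + ‖(c : Vec d) - x.1‖ / Δ * ((‖x.2‖ + R) * (2 * R)) := by
    rintro ⟨c', w'⟩
    have m : P (c, w) ∈ domain R Δ (c : Vec d) := proj_domain_mem hΔ.le c.2 w
    have m' : P (c', w') ∈ domain R Δ (c' : Vec d) := proj_domain_mem hΔ.le c'.2 w'
    have h1 := inner_sub_proj_domain_le hΔ c'.2 c.2 w m'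
    have h2 := inner_sub_proj_domain_le hΔ c.2 c'.2 w' m
    change inner ℝ (w - P (c, w)) (P (c', w') - P (c, w)) ≤ _ at h1
    change inner ℝ (w' - P (c', w')) (P (c, w) - P (c', w')) ≤ _ at h2
    set p := P (c, w)
    set p' := P (c', w')
    have e : inner ℝ (w - p) (p' - p) + inner ℝ (w' - p') (p - p')
        = inner ℝ (w - w') (p' - p) + ‖p' - p‖ ^ 2 := by
      rw [← real_inner_self_eq_norm_sq, ← inner_add_left, ← neg_sub p' p, inner_neg_right,
        ← sub_eq_add_neg, ← inner_sub_left]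
      congr 1; abel
    have h3 : -inner ℝ (w - w') (p' - p) ≤ ‖w - w'‖ * (2 * R) := by
      refine (neg_le_abs _).trans ((abs_real_inner_le_norm _ _).trans ?_)
      gcongr
      refine (norm_sub_le _ _).trans ?_
      have b1 : ‖p'‖ ≤ R := m'.1
      have b2 : ‖p‖ ≤ R := m.1
      linarith
    change ‖p' - p‖ ^ 2 ≤ ‖w - w'‖ * (2 * R) + ‖(c' : Vec d) - c‖ / Δ * ((‖w‖ + R) * (2 * R))
        + ‖(c : Vec d) - c'‖ / Δ * ((‖w'‖ + R) * (2 * R))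
    linarith
  have hlim : Filter.Tendsto (fun x : hypotheses d R × Vec d =>
      ‖w - x.2‖ * (2 * R) + ‖(x.1 : Vec d) - c‖ / Δ * ((‖w‖ + R) * (2 * R))
        + ‖(c : Vec d) - x.1‖ / Δ * ((‖x.2‖ + R) * (2 * R))) (nhds (c, w)) (nhds 0) := by
    have hcont : Continuous (fun x : hypotheses d R × Vec d =>
      ‖w - x.2‖ * (2 * R) + ‖(x.1 : Vec d) - c‖ / Δ * ((‖w‖ + R) * (2 * R))
        + ‖(c : Vec d) - x.1‖ / Δ * ((‖x.2‖ + R) * (2 * R))) := by fun_prop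
    have := hcont.tendsto (c, w)
    simpa using this
  have h1 : Filter.Tendsto (fun x => ‖P x - P (c, w)‖ ^ 2) (nhds (c, w)) (nhds 0) :=
    squeeze_zero (fun _ => by positivity) key hlim
  have h2 := (Real.continuous_sqrt.tendsto 0).comp h1
  rw [Real.sqrt_zero] at h2
  refine tendsto_iff_norm_sub_tendsto_zero.2 (h2.congr fun x => ?_)
  exact Real.sqrt_sq (norm_nonneg _)

end

/-! ### Measurability -/

section

variable {d : ℕ} {Y : Type*} [MeasurableSpace Y] {loss : ℝ → Y → ℝ}

/-- Without a topology on the labels, joint measurability of the derivative comes from writing it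
as a limit of difference quotients. -/
theorem measurable_deriv_loss (hm : Measurable (Function.uncurry loss))
    (hd : ∀ y, Differentiable ℝ fun a => loss a y) :
    Measurable fun p : ℝ × Y => deriv (fun a => loss a p.2) p.1 := by
  have hlim : Filter.Tendsto (fun n : ℕ => (1 : ℝ) / ((n : ℝ) + 1)) Filter.atTop
      (nhdsWithin 0 {0}ᶜ) := by
    refine tendsto_nhdsWithin_iff.2 ⟨tendsto_one_div_add_atTop_nhds_zero_nat, ?_⟩
    exact Filter.Eventually.of_forall fun n => (by positivity : (1 : ℝ) / ((n : ℝ) + 1) ≠ 0)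
  refine measurable_of_tendsto_metrizable (f := fun (n : ℕ) (p : ℝ × Y) =>
    ((1 : ℝ) / ((n : ℝ) + 1))⁻¹ • (loss (p.1 + 1 / ((n : ℝ) + 1)) p.2 - loss p.1 p.2)) ?_ ?_
  · intro n
    have h1 : Measurable fun p : ℝ × Y => loss (p.1 + 1 / ((n : ℝ) + 1)) p.2 :=
      hm.comp (by fun_prop : Measurable fun p : ℝ × Y => (p.1 + 1 / ((n : ℝ) + 1), p.2))
    have h2 : Measurable fun p : ℝ × Y => loss p.1 p.2 := hm
    exact (h1.sub h2).const_mul _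
  · rw [tendsto_pi_nhds]
    intro p
    exact (hasDerivAt_iff_tendsto_slope_zero.1 (hd p.2 p.1).hasDerivAt).comp hlim

theorem measurable_loss_inner (hm : Measurable (Function.uncurry loss)) :
    Measurable fun p : Vec d × (Vec d × Y) => loss (inner ℝ p.1 p.2.1) p.2.2 :=
  hm.comp (by fun_prop :
    Measurable fun p : Vec d × (Vec d × Y) => (inner ℝ p.1 p.2.1, p.2.2))

theorem measurable_stochGrad (hm : Measurable (Function.uncurry loss))
    (hd : ∀ y, Differentiable ℝ fun a => loss a y) :
    Measurable fun p : Vec d × (Vec d × Y) => stochGrad loss p.1 p.2 := by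
  have h1 : Measurable fun p : Vec d × (Vec d × Y) =>
      deriv (fun a => loss a p.2.2) (inner ℝ p.1 p.2.1) :=
    (measurable_deriv_loss hm hd).comp (by fun_prop :
      Measurable fun p : Vec d × (Vec d × Y) => ((inner ℝ p.1 p.2.1 : ℝ), p.2.2))
  exact h1.smul (by fun_prop)

theorem measurable_clip (γ : ℝ) : Measurable (clip γ) := by
  have h : Measurable Real.sign := by
    unfold Real.sign
    exact Measurable.ite measurableSet_Iio measurable_const
      (Measurable.ite measurableSet_Ioi measurable_const measurable_const)
  exact h.mul (measurable_const.min measurable_norm)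

theorem measurable_clipVec (γ : ℝ) : Measurable (clipVec (d := d) γ) := by
  have h : Measurable fun g : Vec d => fun i => clip γ (g i) :=
    measurable_pi_lambda _ fun i => (measurable_clip γ).comp (by fun_prop)
  exact (WithLp.measurable_toLp 2 _).comp h

theorem measurable_risk (D : Measure (Vec d × Y)) [SFinite D]
    (hm : Measurable (Function.uncurry loss)) : Measurable (risk D loss) := by
  have := (measurable_loss_inner (d := d) hm).stronglyMeasurable.integral_prod_right' (ν := D)
  exact this.measurable

/-! ### Consequences of the setting -/

namespace Setting
variable {D : Measure (Vec d × Y)} {α β R : ℝ}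

theorem risk_nonneg (h : Setting D loss α β R) (w : Vec d) : 0 ≤ risk D loss w :=
  integral_nonneg fun _ => h.loss_nonneg _ _

/-- Smoothness dominates the losses over the hypothesis class by the integrable loss at the
origin, whence the risk is continuous up to the boundary of the class. -/
theorem continuousOn_risk (h : Setting D loss α β R) (hβ : 0 < β) (hR : 0 ≤ R) :
    ContinuousOn (risk D loss) (hypotheses d R) := by
  have := h.isProbability
  have h0 := h.integrable_loss 0 (zero_mem_hypotheses hR)
  simp only [inner_zero_left] at h0
  refine continuousOn_of_dominated
    (bound := fun z => loss 0 z.2 + (1 + 2 * β * loss 0 z.2) * R + β / 2 * R ^ 2)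
    (fun w hw => (h.integrable_loss w hw).aestronglyMeasurable) ?_ ?_ ?_
  · intro w hw
    filter_upwards [h.norm_le_one] with z hz
    rw [Real.norm_of_nonneg (h.loss_nonneg _ _)]
    set a : ℝ := inner ℝ w z.1
    have ha : |a| ≤ R := by
      refine (abs_real_inner_le_norm _ _).trans ?_
      calc ‖w‖ * ‖z.1‖ ≤ R * 1 := mul_le_mul hw hz (norm_nonneg _) hR
        _ = R := mul_one R
    have h1 := (h.loss_smooth z.2).2 a 0
    have h2 := (h.loss_smooth z.2).sq_deriv_le hβ (fun a => h.loss_nonneg a z.2) 0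
    set g := deriv (fun a => loss a z.2) 0
    have h3 : |g| ≤ 1 + 2 * β * loss 0 z.2 := by
      have := sq_abs g
      nlinarith [sq_nonneg (|g| - 1), abs_nonneg g]
    have h4 : g * (a - 0) ≤ (1 + 2 * β * loss 0 z.2) * R := by
      rw [sub_zero]
      refine (le_abs_self _).trans ?_
      rw [abs_mul]
      exact mul_le_mul h3 ha (abs_nonneg _) ((abs_nonneg _).trans h3)
    have h5 : β / 2 * (a - 0) ^ 2 ≤ β / 2 * R ^ 2 := by
      rw [sub_zero, ← sq_abs]; gcongr
    exact h1.trans (add_le_add (add_le_add le_rfl h4) h5)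
  · exact (h0.add (((integrable_const 1).add (h0.const_mul (2 * β))).mul_const R)).add
      (integrable_const _)
  · refine Filter.Eventually.of_forall fun z => Continuous.continuousOn ?_
    exact (h.loss_smooth z.2).1.continuous.comp (by fun_prop)

theorem exists_minimizer (h : Setting D loss α β R) (hβ : 0 < β) (hR : 0 ≤ R) :
    ∃ w₀ ∈ hypotheses d R, risk D loss w₀ = optRisk D loss R ∧
      ∀ w ∈ hypotheses d R, risk D loss w₀ ≤ risk D loss w := by
  obtain ⟨w₀, hw₀, hmin⟩ := (isCompact_hypotheses R).exists_sInf_image_eq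
    ⟨0, zero_mem_hypotheses hR⟩ (h.continuousOn_risk hβ hR)
  refine ⟨w₀, hw₀, hmin.symm, fun w hw => ?_⟩
  rw [← hmin]
  exact csInf_le ⟨0, by rintro _ ⟨v, -, rfl⟩; exact h.risk_nonneg v⟩ ⟨w, hw, rfl⟩

/-- Quadratic growth of the risk away from its minimiser over the class, which may lie on the
boundary. -/
theorem sq_norm_sub_le (h : Setting D loss α β R) {w₀ w : Vec d} (hw₀ : w₀ ∈ hypotheses d R)
    (hmin : ∀ w ∈ hypotheses d R, risk D loss w₀ ≤ risk D loss w) (hw : w ∈ hypotheses d R) :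
    α / 2 * ‖w - w₀‖ ^ 2 ≤ risk D loss w - risk D loss w₀ := by
  have key : ∀ t ∈ Set.Ioo (0 : ℝ) 1,
      (1 - t) * (α / 2 * ‖w - w₀‖ ^ 2) ≤ risk D loss w - risk D loss w₀ := by
    rintro t ⟨ht0, ht1⟩
    have h1 := h.risk_strongConvex.2 hw hw₀ ht0.le (by linarith : 0 ≤ 1 - t) (by ring)
    have h2 := hmin _ (convex_hypotheses R hw hw₀ ht0.le (by linarith : 0 ≤ 1 - t) (by ring))
    simp only [smul_eq_mul] at h1
    have h3 : t * ((1 - t) * (α / 2 * ‖w - w₀‖ ^ 2)) ≤ t * (risk D loss w - risk D loss w₀) := by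
      linarith
    exact le_of_mul_le_mul_left h3 ht0
  have hlim : Filter.Tendsto (fun t : ℝ => (1 - t) * (α / 2 * ‖w - w₀‖ ^ 2))
      (nhdsWithin 0 (Set.Ioi 0)) (nhds (α / 2 * ‖w - w₀‖ ^ 2)) := by
    have : Continuous fun t : ℝ => (1 - t) * (α / 2 * ‖w - w₀‖ ^ 2) := by fun_prop
    simpa using (this.tendsto 0).mono_left nhdsWithin_le_nhds
  exact le_of_tendsto hlim (Filter.mem_of_superset (Ioo_mem_nhdsGT one_pos) key)

/-- The risk inherits `β`-smoothness from the losses, so its modulus of strong convexity is at most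
`β`: compare second differences at the origin along a diameter of the class. -/
theorem alpha_le_beta (h : Setting D loss α β R) (hβ : 0 < β) (hR : 0 < R) (hd : 1 ≤ d) :
    α ≤ β := by
  have := h.isProbability
  set e : Vec d := EuclideanSpace.single ⟨0, hd⟩ R with he
  have hen : ‖e‖ = R := by rw [he, PiLp.norm_single, Real.norm_of_nonneg hR.le]
  have m1 : e ∈ hypotheses d R := hen.le
  have m2 : -e ∈ hypotheses d R := by change ‖-e‖ ≤ R; rw [norm_neg, hen]
  have m0 : (0 : Vec d) ∈ hypotheses d R := zero_mem_hypotheses hR.le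
  have h1 := h.risk_strongConvex.2 m1 m2 (by norm_num : (0 : ℝ) ≤ 1 / 2)
    (by norm_num : (0 : ℝ) ≤ 1 / 2) (by norm_num)
  have e1 : (1 / 2 : ℝ) • e + (1 / 2 : ℝ) • -e = 0 := by module
  have e2 : e - -e = (2 : ℝ) • e := by module
  rw [e1, e2, norm_smul, hen] at h1
  simp only [smul_eq_mul, Real.norm_ofNat] at h1
  have h2 : risk D loss e + risk D loss (-e) ≤ 2 * risk D loss 0 + β * R ^ 2 := by
    have i0 := h.integrable_loss 0 m0
    have i1 := h.integrable_loss e m1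
    have i2 := h.integrable_loss (-e) m2
    have e3 : 2 * risk D loss 0 + β * R ^ 2
        = ∫ z, (2 * loss (inner ℝ (0 : Vec d) z.1) z.2 + β * R ^ 2) ∂D := by
      rw [integral_add (i0.const_mul 2) (integrable_const _), integral_const_mul]
      simp [risk]
    rw [e3]
    unfold risk
    rw [← integral_add i1 i2]
    refine integral_mono_ae (i1.add i2) ((i0.const_mul 2).add (integrable_const _)) ?_
    filter_upwards [h.norm_le_one] with z hz
    have s1 := (h.loss_smooth z.2).2 (inner ℝ e z.1) 0
    have s2 := (h.loss_smooth z.2).2 (inner ℝ (-e) z.1) 0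
    have hb : (inner ℝ e z.1 : ℝ) ^ 2 ≤ R ^ 2 := by
      rw [← sq_abs]
      refine pow_le_pow_left₀ (abs_nonneg _) ((abs_real_inner_le_norm _ _).trans ?_) 2
      rw [hen]; nlinarith [norm_nonneg z.1]
    simp only [inner_neg_left, inner_zero_left, sub_zero] at s1 s2 ⊢
    nlinarith
  have hR2 : 0 < R ^ 2 := by positivity
  nlinarith

end Setting

end

/-! ### Exponential moment of a step -/

section

variable {d : ℕ} {Y : Type*} [MeasurableSpace Y] {loss : ℝ → Y → ℝ}

/-- The progress towards `w₀` of one clipped gradient step from `w` on the example `z`: the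
linearised decrease `⟨v, w - w₀⟩` less the second-order cost `η ‖v‖² / 2` of the step. -/
noncomputable def progress (p : Params) (loss : ℝ → Y → ℝ) (Δ : ℝ) (w₀ w : Vec d) (z : Vec d × Y) : ℝ :=
  inner ℝ (clipVec (2 * p.ξ * p.β * Δ) (stochGrad loss w z)) (w - w₀)
    - p.η / 2 * ‖clipVec (2 * p.ξ * p.β * Δ) (stochGrad loss w z)‖ ^ 2

/-- The clipping bias, the variance and the cost of the step are all at most a multiple of the loss
itself, because the loss is self-bounding; so the exponential moment is bounded by losses only. -/
theorem exp_neg_progress_le {Y : Type*} {loss : ℝ → Y → ℝ} {p : Params} {Δ lam : ℝ} (hβ : 0 < p.β) (hξ : 4 ≤ p.ξ)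
    (hη0 : 0 < p.η) (hη : p.η * (64 * p.ξ * p.β) ≤ 1) (hd : 1 ≤ d) (hΔ : 0 < Δ)
    (hlam : 0 < lam) (hlam1 : lam * (9 * p.ξ * p.β * Real.sqrt d * Δ ^ 2) ≤ 1)
    (hlam2 : lam * (p.β * p.ξ ^ 3 * d * Δ ^ 2) ≤ 2)
    {y : Y} {x w w₀ : Vec d} (hx : ‖x‖ ≤ 1) (h0 : ∀ a, 0 ≤ loss a y)
    (hc : ConvexOn ℝ Set.univ fun a => loss a y) (hs : IsSmooth p.β fun a => loss a y)
    (hw : ‖w - w₀‖ ≤ 2 * Δ) :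
    Real.exp (-(lam * progress p loss Δ w₀ w (x, y))) ≤
      1 + lam * (loss (inner ℝ w₀ x) y - (1 - 2 / p.ξ) * loss (inner ℝ w x) y) := by
  set ξ := p.ξ
  set β := p.β
  set η := p.η
  have hξ0 : 0 < ξ := by linarith
  set l := loss (inner ℝ w x) y with hl
  have hl0 : 0 ≤ l := h0 _
  set γ := 2 * ξ * β * Δ with hγ
  have hγ0 : 0 < γ := by positivity
  set g := stochGrad loss w (x, y) with hg
  set v := clipVec γ g with hv
  have hd1 : (1 : ℝ) ≤ Real.sqrt d := by
    rw [Real.one_le_sqrt]; exact_mod_cast hd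
  have hd2 : Real.sqrt d ^ 2 = d := Real.sq_sqrt (Nat.cast_nonneg d)
  have hg2 : ‖g‖ ^ 2 ≤ 2 * β * l := by
    have h1 : ‖g‖ ≤ |deriv (fun a => loss a y) (inner ℝ w x)| := by
      rw [hg, stochGrad, norm_smul, Real.norm_eq_abs]
      exact mul_le_of_le_one_right (abs_nonneg _) hx
    calc ‖g‖ ^ 2 ≤ |deriv (fun a => loss a y) (inner ℝ w x)| ^ 2 :=
          pow_le_pow_left₀ (norm_nonneg _) h1 2
      _ ≤ 2 * β * l := by rw [sq_abs]; exact hs.sq_deriv_le hβ h0 _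
  have hvg : ‖v‖ ^ 2 ≤ 2 * β * l :=
    (pow_le_pow_left₀ (norm_nonneg _) (norm_clipVec_le hγ0.le g) 2).trans hg2
  have hvd : ‖v‖ ≤ Real.sqrt d * γ := norm_clipVec_le_sqrt hγ0.le g
  set X : ℝ := inner ℝ v (w - w₀) with hX
  have hXabs : |X| ≤ ‖v‖ * (2 * Δ) :=
    (abs_real_inner_le_norm _ _).trans (mul_le_mul_of_nonneg_left hw (norm_nonneg _))
  have hX1 : |X| ≤ 4 * ξ * β * Real.sqrt d * Δ ^ 2 := by
    refine hXabs.trans ((mul_le_mul_of_nonneg_right hvd (by positivity)).trans (le_of_eq ?_))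
    rw [hγ]; ring
  have hX2 : X ^ 2 ≤ 8 * β * Δ ^ 2 * l := by
    have := pow_le_pow_left₀ (abs_nonneg _) hXabs 2
    rw [sq_abs, mul_pow] at this
    nlinarith [mul_le_mul_of_nonneg_right hvg (sq_nonneg (2 * Δ))]
  have hlam3 : lam * (9 * ξ * β * Δ ^ 2) ≤ 1 := by
    refine le_trans ?_ hlam1
    refine mul_le_mul_of_nonneg_left ?_ hlam.le
    have : 0 ≤ 9 * ξ * β * Δ ^ 2 := by positivity
    nlinarith
  refine exp_progress_le hl0 hlam hξ (q := η / 2 * ‖v‖ ^ 2) (by positivity) ?_ ?_ ?_ ?_ ?_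
  · nlinarith [mul_le_mul_of_nonneg_left hX1 hlam.le]
  · have e : 8 / (9 * ξ) * l = 8 * l / (9 * ξ) := by ring
    rw [e, le_div_iff₀ (by positivity)]
    calc lam * X ^ 2 * (9 * ξ) ≤ lam * (8 * β * Δ ^ 2 * l) * (9 * ξ) := by gcongr
      _ = lam * (9 * ξ * β * Δ ^ 2) * (8 * l) := by ring
      _ ≤ 1 * (8 * l) := mul_le_mul_of_nonneg_right hlam3 (by positivity)
      _ = 8 * l := one_mul _
  · rw [le_div_iff₀ (by positivity)]
    calc η / 2 * ‖v‖ ^ 2 * (64 * ξ) ≤ η / 2 * (2 * β * l) * (64 * ξ) := by gcongr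
      _ = η * (64 * ξ * β) * l := by ring
      _ ≤ 1 * l := mul_le_mul_of_nonneg_right hη hl0
      _ = l := one_mul _
  · have h1 : ‖v‖ ^ 2 ≤ d * γ ^ 2 := by
      have := pow_le_pow_left₀ (norm_nonneg _) hvd 2
      rwa [mul_pow, hd2] at this
    have h2 : lam * (η / 2 * ‖v‖ ^ 2) * (32 * ξ ^ 2) ≤ 2 := by
      calc lam * (η / 2 * ‖v‖ ^ 2) * (32 * ξ ^ 2)
          ≤ lam * (η / 2 * (d * γ ^ 2)) * (32 * ξ ^ 2) := by gcongr
        _ = η * (64 * ξ * β) * (lam * (β * ξ ^ 3 * d * Δ ^ 2)) := by rw [hγ]; ring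
        _ ≤ 1 * 2 := mul_le_mul hη hlam2 (by positivity) zero_le_one
        _ = 2 := one_mul _
    have h3 : (16 : ℝ) ≤ ξ ^ 2 := by nlinarith
    have h4 : 0 ≤ lam * (η / 2 * ‖v‖ ^ 2) := by positivity
    nlinarith
  · have h1 : l - loss (inner ℝ w₀ x) y ≤ inner ℝ g (w - w₀) := by
      have := sub_le_deriv_mul hc hs.1 (inner ℝ w x) (inner ℝ w₀ x)
      refine this.trans (le_of_eq ?_)
      rw [hg, stochGrad, real_inner_smul_left, ← inner_sub_left, real_inner_comm x (w - w₀)]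
    have h2 : inner ℝ g (w - w₀) = inner ℝ (g - v) (w - w₀) + X := by
      rw [hX, ← inner_add_left, sub_add_cancel]
    have h3 : inner ℝ (g - v) (w - w₀) ≤ l / (2 * ξ) := by
      refine (inner_sub_clipVec_le hγ0 g _).trans ?_
      calc ‖g‖ ^ 2 / (4 * γ) * ‖w - w₀‖ ≤ (2 * β * l) / (4 * γ) * (2 * Δ) := by gcongr
        _ = l / (2 * ξ) := by rw [hγ]; field_simp; ring
    linarith

/-- The exponential of the excess at `w` of the discounted risk gap over the progress made on `z`.
It is set to zero outside the region `‖w - w₀‖ ≤ 2Δ` of the hypothesis class, where its mean is not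
controlled; the iterates of a stage whose domain contains `w₀` never leave that region. -/
noncomputable def weight (p : Params) (D : Measure (Vec d × Y)) (loss : ℝ → Y → ℝ)
    (Δ lam : ℝ) (w₀ w : Vec d) (z : Vec d × Y) : ℝ≥0∞ :=
  (domain p.R (2 * Δ) w₀).indicator (fun w => ENNReal.ofReal (Real.exp
    (lam * ((1 - 2 / p.ξ) * risk D loss w - risk D loss w₀ - progress p loss Δ w₀ w z)))) w

/-- The exponent is centred so that the pointwise bound integrates to `exp a * (1 - a) ≤ 1`. -/
theorem lintegral_weight_le_one {p : Params} {D : Measure (Vec d × Y)} {α Δ lam : ℝ}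
    (h : Setting D loss α p.β p.R) (hβ : 0 < p.β) (hξ : 4 ≤ p.ξ)
    (hη0 : 0 < p.η) (hη : p.η * (64 * p.ξ * p.β) ≤ 1) (hd : 1 ≤ d) (hΔ : 0 < Δ)
    (hlam : 0 < lam) (hlam1 : lam * (9 * p.ξ * p.β * Real.sqrt d * Δ ^ 2) ≤ 1)
    (hlam2 : lam * (p.β * p.ξ ^ 3 * d * Δ ^ 2) ≤ 2)
    {w₀ : Vec d} (hw₀ : w₀ ∈ hypotheses d p.R) (w : Vec d) :
    ∫⁻ z, weight p D loss Δ lam w₀ w z ∂D ≤ 1 := by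
  have := h.isProbability
  unfold weight
  by_cases hw : w ∈ domain p.R (2 * Δ) w₀
  swap
  · simp [hw]
  simp only [Set.indicator_of_mem hw]
  set A := (1 - 2 / p.ξ) * risk D loss w - risk D loss w₀ with hA
  set g : Vec d × Y → ℝ := fun z => Real.exp (lam * A) *
    (1 + lam * (loss (inner ℝ w₀ z.1) z.2 - (1 - 2 / p.ξ) * loss (inner ℝ w z.1) z.2)) with hg
  have hle : ∀ᵐ z ∂D, Real.exp (lam * (A - progress p loss Δ w₀ w z)) ≤ g z := by
    filter_upwards [h.norm_le_one] with z hz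
    have h1 := exp_neg_progress_le (x := z.1) (y := z.2) hβ hξ hη0 hη hd hΔ hlam hlam1 hlam2 hz
      (fun a => h.loss_nonneg a z.2) (h.loss_convex z.2) (h.loss_smooth z.2) hw.2
    rw [mul_sub, sub_eq_add_neg, Real.exp_add]
    exact mul_le_mul_of_nonneg_left h1 (Real.exp_pos _).le
  have i0 := h.integrable_loss w₀ hw₀
  have i1 := h.integrable_loss w hw.1
  have hgi : Integrable g D :=
    ((integrable_const 1).add ((i0.sub (i1.const_mul _)).const_mul lam)).const_mul _
  have hint : ∫ z, g z ∂D = Real.exp (lam * A) * (1 - lam * A) := by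
    rw [hg, integral_const_mul]
    congr 1
    rw [integral_add (integrable_const _) (by exact (i0.sub (i1.const_mul _)).const_mul lam),
      integral_const_mul, integral_sub i0 (i1.const_mul _), integral_const_mul, hA]
    simp only [integral_const, probReal_univ, smul_eq_mul, risk]
    ring
  calc ∫⁻ z, ENNReal.ofReal (Real.exp (lam * (A - progress p loss Δ w₀ w z))) ∂D
      ≤ ∫⁻ z, ENNReal.ofReal (g z) ∂D :=
        lintegral_mono_ae (hle.mono fun z hz => ENNReal.ofReal_le_ofReal hz)
    _ = ENNReal.ofReal (∫ z, g z ∂D) :=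
        (ofReal_integral_eq_lintegral_ofReal hgi
          (hle.mono fun z hz => (Real.exp_pos _).le.trans hz)).symm
    _ ≤ 1 := by
        rw [hint, ENNReal.ofReal_le_one]
        calc Real.exp (lam * A) * (1 - lam * A) ≤ Real.exp (lam * A) * Real.exp (-(lam * A)) :=
              mul_le_mul_of_nonneg_left
                (by linarith [Real.add_one_le_exp (-(lam * A))]) (Real.exp_pos _).le
          _ = 1 := by rw [← Real.exp_add, add_neg_cancel, Real.exp_zero]

theorem measurable_progress (p : Params) (hm : Measurable (Function.uncurry loss))
    (hd : ∀ y, Differentiable ℝ fun a => loss a y) (Δ : ℝ) (w₀ : Vec d) :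
    Measurable fun q : Vec d × (Vec d × Y) => progress p loss Δ w₀ q.1 q.2 := by
  have hv := (measurable_clipVec (2 * p.ξ * p.β * Δ)).comp (measurable_stochGrad (d := d) hm hd)
  exact (hv.inner (measurable_fst.sub_const w₀)).sub ((hv.norm.pow_const 2).const_mul _)

theorem measurable_weight (p : Params) (D : Measure (Vec d × Y)) [SFinite D]
    (hm : Measurable (Function.uncurry loss))
    (hd : ∀ y, Differentiable ℝ fun a => loss a y) (Δ lam : ℝ) (w₀ : Vec d) :
    Measurable fun q : Vec d × (Vec d × Y) => weight p D loss Δ lam w₀ q.1 q.2 := by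
  have h1 : Measurable fun q : Vec d × (Vec d × Y) => ENNReal.ofReal (Real.exp
      (lam * ((1 - 2 / p.ξ) * risk D loss q.1 - risk D loss w₀ -
        progress p loss Δ w₀ q.1 q.2))) := by
    have hr : Measurable fun q : Vec d × (Vec d × Y) => risk D loss q.1 :=
      (measurable_risk D hm).comp measurable_fst
    have hp := measurable_progress p hm hd Δ w₀
    exact ((((hr.const_mul _).sub_const _).sub hp).const_mul lam).exp.ennreal_ofReal
  have hs : MeasurableSet {q : Vec d × (Vec d × Y) | q.1 ∈ domain p.R (2 * Δ) w₀} :=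
    measurable_fst (isComplete_domain p.R (2 * Δ) w₀).isClosed.measurableSet
  exact h1.indicator hs

/-! ### Fresh examples are independent of the past -/

section Sampling
variable {Ω E : Type*} [MeasurableSpace E]

/-- The σ-algebra of the examples drawn before time `i`. -/
@[reducible] def past (Z : ℕ → Ω → E) (i : ℕ) : MeasurableSpace Ω :=
  ⨆ j ∈ Set.Iio i, MeasurableSpace.comap (Z j) inferInstance

theorem past_mono (Z : ℕ → Ω → E) {i j : ℕ} (hij : i ≤ j) : past Z i ≤ past Z j :=
  biSup_mono fun _ hk => lt_of_lt_of_le hk hij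

theorem measurable_past (Z : ℕ → Ω → E) {i j : ℕ} (hij : i < j) : Measurable[past Z j] (Z i) :=
  measurable_iff_comap_le.2 (le_biSup (fun k => MeasurableSpace.comap (Z k) _) hij)

theorem past_le {mΩ : MeasurableSpace Ω} {Z : ℕ → Ω → E} (hZ : ∀ i, Measurable (Z i)) (i : ℕ) : past Z i ≤ mΩ :=
  iSup₂_le fun j _ => (hZ j).comap_le

theorem indepFun_of_measurable_past {mΩ : MeasurableSpace Ω} {P : Measure Ω} {Z : ℕ → Ω → E} (hZ : ∀ i, Measurable (Z i))
    (hind : iIndepFun Z P) {i : ℕ} {S : Type*} [MeasurableSpace S] {U : Ω → S}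
    (hU : Measurable[past Z i] U) : IndepFun U (Z i) P := by
  have h := indep_iSup_of_disjoint (fun j => (hZ j).comap_le) hind.iIndep
    (S := Set.Iio i) (T := {i}) (by simp)
  rw [IndepFun_iff_Indep]
  exact indep_of_indep_of_le_right (indep_of_indep_of_le_left h hU.comap_le) (by simp)

/-- Integrating out an independent variable first, as in a conditional expectation. -/
theorem lintegral_prodMk_le_of_indepFun {mΩ : MeasurableSpace Ω} {P : Measure Ω} [IsFiniteMeasure P] {S : Type*}
    [MeasurableSpace S] {U : Ω → S} {V : Ω → E} (hU : Measurable U) (hV : Measurable V)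
    (hind : IndepFun U V P) {G : S × E → ℝ≥0∞} (hG : Measurable G) {g : S → ℝ≥0∞}
    (hg : Measurable g) (hle : ∀ u, ∫⁻ z, G (u, z) ∂(P.map V) ≤ g u) :
    ∫⁻ ω, G (U ω, V ω) ∂P ≤ ∫⁻ ω, g (U ω) ∂P := by
  rw [← lintegral_map hG (hU.prodMk hV),
    (indepFun_iff_map_prod_eq_prod_map_map hU.aemeasurable hV.aemeasurable).1 hind,
    lintegral_prod _ hG.aemeasurable, ← lintegral_map hg hU]
  exact lintegral_mono hle

end Sampling

end

/-! ### Iterates of a stage -/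

section

variable {d : ℕ} {Y : Type*} {loss : ℝ → Y → ℝ}

theorem stageIterate_mem {p : Params} {c : Vec d} {Δ : ℝ} (hΔ : 0 ≤ Δ)
    (hc : c ∈ hypotheses d p.R) (S : ℕ → Vec d × Y) (t : ℕ) :
    stageIterate p loss c Δ S t ∈ domain p.R Δ c := by
  cases t with
  | zero => exact center_mem_domain hΔ hc
  | succ t => exact proj_domain_mem hΔ hc _

theorem stageAverage_mem {p : Params} (hT : 0 < p.T₁) {c : Vec d} {Δ : ℝ} (hΔ : 0 ≤ Δ)
    (hc : c ∈ hypotheses d p.R) (S : ℕ → Vec d × Y) :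
    stageAverage p loss c Δ S ∈ hypotheses d p.R := by
  have hT' : (p.T₁ : ℝ) ≠ 0 := by positivity
  rw [stageAverage, Finset.smul_sum]
  exact (convex_hypotheses p.R).sum_mem (fun _ _ => by positivity) (by simp [hT'])
    fun t _ => (stageIterate_mem hΔ hc S t).1

theorem output_mem {p : Params} (hT : 0 < p.T₁) (hR : 0 ≤ p.R) (hΔ : ∀ k, 0 ≤ domainSize p k)
    (S : ℕ → Vec d × Y) (k : ℕ) : output p loss S k ∈ hypotheses d p.R := by
  induction k with
  | zero => exact zero_mem_hypotheses hR
  | succ k ih => exact stageAverage_mem hT (hΔ k) ih _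

/-- The regret bound of projected gradient descent: each step decreases `‖w - w₀‖²` by at least
`2η` times its progress, as projecting onto a convex set containing `w₀` only brings one closer. -/
theorem sum_progress_le {p : Params} {c w₀ : Vec d} {Δ : ℝ} (hη : 0 < p.η) (hΔ : 0 ≤ Δ)
    (hc : c ∈ hypotheses d p.R) (hw₀ : w₀ ∈ hypotheses d p.R) (hcw : ‖c - w₀‖ ≤ Δ)
    (S : ℕ → Vec d × Y) (n : ℕ) :
    ∑ t ∈ Finset.range n, progress p loss Δ w₀ (stageIterate p loss c Δ S t) (S t)
      ≤ Δ ^ 2 / (2 * p.η) := by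
  have hw₀' : w₀ ∈ domain p.R Δ c := ⟨hw₀, by rwa [norm_sub_rev]⟩
  have key : ∑ t ∈ Finset.range n, progress p loss Δ w₀ (stageIterate p loss c Δ S t) (S t)
      ≤ (Δ ^ 2 - ‖stageIterate p loss c Δ S n - w₀‖ ^ 2) / (2 * p.η) := by
    induction n with
    | zero =>
      rw [Finset.sum_range_zero]
      have : ‖c - w₀‖ ^ 2 ≤ Δ ^ 2 := pow_le_pow_left₀ (norm_nonneg _) hcw 2
      exact div_nonneg (sub_nonneg.2 this) (by positivity)
    | succ n ih =>
      rw [Finset.sum_range_succ]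
      set w := stageIterate p loss c Δ S n with hw
      set v := clipVec (2 * p.ξ * p.β * Δ) (stochGrad loss w (S n)) with hv
      have h1 : ‖stageIterate p loss c Δ S (n + 1) - w₀‖ ≤ ‖w - p.η • v - w₀‖ :=
        norm_proj_sub_le ⟨c, center_mem_domain hΔ hc⟩ (isComplete_domain _ _ _)
          (convex_domain _ _ _) _ hw₀'
      have h2 := pow_le_pow_left₀ (norm_nonneg _) h1 2
      have h3 : ‖w - p.η • v - w₀‖ ^ 2
          = ‖w - w₀‖ ^ 2 - 2 * (p.η * inner ℝ v (w - w₀)) + p.η ^ 2 * ‖v‖ ^ 2 := by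
        have e : w - p.η • v - w₀ = (w - w₀) - p.η • v := by abel
        rw [e, norm_sub_sq_real, inner_smul_right, norm_smul, mul_pow, Real.norm_eq_abs, sq_abs,
          real_inner_comm]
      have h4 : progress p loss Δ w₀ w (S n)
          ≤ (‖w - w₀‖ ^ 2 - ‖stageIterate p loss c Δ S (n + 1) - w₀‖ ^ 2) / (2 * p.η) := by
        rw [le_div_iff₀ (by positivity), progress, ← hv]
        nlinarith
      refine (add_le_add ih h4).trans (le_of_eq ?_)
      rw [← add_div]; congr 1; ring
  refine key.trans ?_
  gcongr
  have := sq_nonneg ‖stageIterate p loss c Δ S n - w₀‖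
  linarith

variable [MeasurableSpace Y]

theorem risk_stageAverage_le {p : Params} {D : Measure (Vec d × Y)} {α β : ℝ}
    (h : Setting D loss α β p.R) (hα : 0 ≤ α) (hT : 0 < p.T₁) {c : Vec d} {Δ : ℝ} (hΔ : 0 ≤ Δ)
    (hc : c ∈ hypotheses d p.R) (S : ℕ → Vec d × Y) :
    p.T₁ * risk D loss (stageAverage p loss c Δ S)
      ≤ ∑ t ∈ Finset.range p.T₁, risk D loss (stageIterate p loss c Δ S t) := by
  have hT' : (0 : ℝ) < p.T₁ := by exact_mod_cast hT
  have hconv : ConvexOn ℝ (hypotheses d p.R) (risk D loss) :=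
    UniformConvexOn.convexOn h.risk_strongConvex fun r => by simp only [Pi.zero_apply]; positivity
  have h1 := hconv.map_sum_le (t := Finset.range p.T₁) (w := fun _ => 1 / (p.T₁ : ℝ))
    (p := fun t => stageIterate p loss c Δ S t) (fun _ _ => by positivity)
    (by simp [hT'.ne']) fun t _ => (stageIterate_mem hΔ hc S t).1
  rw [← Finset.smul_sum, ← Finset.smul_sum] at h1
  have h2 := mul_le_mul_of_nonneg_left h1 hT'.le
  refine h2.trans (le_of_eq ?_)
  rw [smul_eq_mul, ← mul_assoc, mul_one_div_cancel hT'.ne', one_mul]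

/-! ### Probability bound for a stage -/

section Sampling
variable {Ω : Type*}

theorem measurable_proj_step (p : Params) {Δ : ℝ} (hΔ : 0 < Δ)
    (hm : Measurable (Function.uncurry loss)) (hd : ∀ y, Differentiable ℝ fun a => loss a y) :
    Measurable fun q : hypotheses d p.R × (Vec d × (Vec d × Y)) =>
      proj (domain p.R Δ (q.1 : Vec d)) (q.2.1 - p.η •
        clipVec (2 * p.ξ * p.β * Δ) (stochGrad loss q.2.1 q.2.2)) := by
  have hv : Measurable fun q : Vec d × (Vec d × Y) =>
      q.1 - p.η • clipVec (2 * p.ξ * p.β * Δ) (stochGrad loss q.1 q.2) :=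
    measurable_fst.sub
      (((measurable_clipVec _).comp (measurable_stochGrad (d := d) hm hd)).const_smul p.η)
  have hpair : Measurable fun q : hypotheses d p.R × (Vec d × (Vec d × Y)) =>
      (q.1, q.2.1 - p.η • clipVec (2 * p.ξ * p.β * Δ) (stochGrad loss q.2.1 q.2.2)) :=
    measurable_fst.prodMk (hv.comp measurable_snd)
  have hstep := (continuous_proj_domain (d := d) (R := p.R) hΔ).measurable.comp hpair
  exact hstep

theorem measurable_stageIterate {p : Params} {Δ : ℝ} (hΔ : 0 < Δ)
    (hm : Measurable (Function.uncurry loss)) (hd : ∀ y, Differentiable ℝ fun a => loss a y)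
    {Z : ℕ → Ω → Vec d × Y} {j : ℕ} {c : Ω → Vec d} (hcm : Measurable[past Z j] c)
    (hc : ∀ ω, c ω ∈ hypotheses d p.R) (t : ℕ) :
    Measurable[past Z (j + t)]
      fun ω => stageIterate p loss (c ω) Δ (fun s => Z (j + s) ω) t := by
  induction t with
  | zero => exact hcm
  | succ t ih =>
    have hcm' : Measurable[past Z (j + (t + 1))] c := hcm.mono (past_mono Z (by omega)) le_rfl
    have hw := ih.mono (past_mono Z (by omega : j + t ≤ j + (t + 1))) le_rfl
    have hz : Measurable[past Z (j + (t + 1))] (Z (j + t)) := measurable_past Z (by omega)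
    let _ : MeasurableSpace Ω := past Z (j + (t + 1))
    have hstep := (measurable_proj_step p hΔ hm hd).comp
      ((hcm'.subtype_mk (h := hc)).prodMk (hw.prodMk hz))
    exact hstep

theorem measurable_output {p : Params} (hT : 0 < p.T₁) (hR : 0 ≤ p.R)
    (hΔ : ∀ k, 0 < domainSize p k)
    (hm : Measurable (Function.uncurry loss)) (hd : ∀ y, Differentiable ℝ fun a => loss a y)
    (Z : ℕ → Ω → Vec d × Y) (k : ℕ) :
    Measurable[past Z (k * p.T₁)] fun ω => output p loss (fun i => Z i ω) k := by
  induction k with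
  | zero => exact measurable_const
  | succ k ih =>
    have h1 : ∀ t ∈ Finset.range p.T₁, Measurable[past Z ((k + 1) * p.T₁)] fun ω =>
        stageIterate p loss (output p loss (fun i => Z i ω) k) (domainSize p k)
          (fun s => Z (k * p.T₁ + s) ω) t := fun t ht =>
      (measurable_stageIterate (hΔ k) hm hd ih
        (fun ω => output_mem hT hR (fun k => (hΔ k).le) _ k) t).mono
        (past_mono Z (by rw [Finset.mem_range] at ht; rw [add_mul]; omega)) le_rfl
    let _ : MeasurableSpace Ω := past Z ((k + 1) * p.T₁)
    exact (Finset.measurable_fun_sum _ h1).const_smul (1 / (p.T₁ : ℝ))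

variable [mΩ : MeasurableSpace Ω]

/-- The product of the weights along a stage is a supermartingale, so its mean is at most one;
Markov's inequality then bounds the probability that the total excess is large. -/
theorem measure_excess_le {p : Params} {D : Measure (Vec d × Y)} {α Δ lam : ℝ}
    (h : Setting D loss α p.β p.R) (hβ : 0 < p.β) (hξ : 4 ≤ p.ξ)
    (hη0 : 0 < p.η) (hη : p.η * (64 * p.ξ * p.β) ≤ 1) (hd : 1 ≤ d) (hΔ : 0 < Δ)
    (hlam : 0 < lam) (hlam1 : lam * (9 * p.ξ * p.β * Real.sqrt d * Δ ^ 2) ≤ 1)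
    (hlam2 : lam * (p.β * p.ξ ^ 3 * d * Δ ^ 2) ≤ 2)
    {w₀ : Vec d} (hw₀ : w₀ ∈ hypotheses d p.R)
    {P : Measure Ω} [IsProbabilityMeasure P] {Z : ℕ → Ω → Vec d × Y} (hZ : IsIIDSample P D Z)
    {j : ℕ} {c : Ω → Vec d} (hcm : Measurable[past Z j] c)
    (hc : ∀ ω, c ω ∈ hypotheses d p.R) (n : ℕ) (u : ℝ) :
    P {ω | ‖c ω - w₀‖ ≤ Δ ∧ u ≤ ∑ t ∈ Finset.range n, lam *
        ((1 - 2 / p.ξ) * risk D loss (stageIterate p loss (c ω) Δ (fun s => Z (j + s) ω) t)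
          - risk D loss w₀ - progress p loss Δ w₀
            (stageIterate p loss (c ω) Δ (fun s => Z (j + s) ω) t) (Z (j + t) ω))}
      ≤ ENNReal.ofReal (Real.exp (-u)) := by
  have := h.isProbability
  have hdiff : ∀ y, Differentiable ℝ fun a => loss a y := fun y => (h.loss_smooth y).1
  set W : ℕ → Ω → Vec d := fun t ω => stageIterate p loss (c ω) Δ (fun s => Z (j + s) ω) t
    with hW
  have hWm : ∀ t, Measurable[past Z (j + t)] (W t) :=
    measurable_stageIterate hΔ h.measurable_loss hdiff hcm hc
  have hGm := measurable_weight p D h.measurable_loss hdiff Δ lam w₀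
  set M : ℕ → Ω → ℝ≥0∞ := fun n ω =>
    ∏ t ∈ Finset.range n, weight p D loss Δ lam w₀ (W t ω) (Z (j + t) ω) with hM
  have hMm : ∀ n, Measurable[past Z (j + n)] (M n) := fun n => by
    refine Finset.measurable_fun_prod _ fun t ht => ?_
    rw [Finset.mem_range] at ht
    have hpair := ((hWm t).mono (past_mono Z (by omega : j + t ≤ j + n)) le_rfl).prodMk
      (measurable_past Z (by omega : j + t < j + n))
    have hcomp := hGm.comp hpair
    exact hcomp
  have hM1 : ∀ n, ∫⁻ ω, M n ω ∂P ≤ 1 := by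
    intro n
    induction n with
    | zero => simp [hM]
    | succ n ih =>
      refine le_trans ?_ ih
      have hU : Measurable[past Z (j + n)] fun ω => (M n ω, W n ω) := (hMm n).prodMk (hWm n)
      have hG : Measurable fun q : (ℝ≥0∞ × Vec d) × (Vec d × Y) =>
          q.1.1 * weight p D loss Δ lam w₀ q.1.2 q.2 := by
        have h2 := hGm.comp ((measurable_snd.comp measurable_fst).prodMk measurable_snd :
          Measurable fun q : (ℝ≥0∞ × Vec d) × (Vec d × Y) => (q.1.2, q.2))
        exact (measurable_fst.comp measurable_fst).mul h2
      have key := lintegral_prodMk_le_of_indepFun (P := P)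
        (hU.mono (past_le hZ.measurable _) le_rfl) (hZ.measurable (j + n))
        (indepFun_of_measurable_past hZ.measurable hZ.indep hU)
        hG (g := fun q => q.1) measurable_fst (fun q => by
          have hq : Measurable fun z => weight p D loss Δ lam w₀ q.2 z := by
            have hcomp := hGm.comp (measurable_prodMk_left (x := q.2))
            exact hcomp
          rw [hZ.law]
          dsimp only
          rw [lintegral_const_mul _ hq]
          exact mul_le_of_le_one_right' (lintegral_weight_le_one h hβ hξ hη0 hη hd hΔ hlam hlam1
            hlam2 hw₀ q.2))
      simpa only [hM, Finset.prod_range_succ] using key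
  have hmarkov := mul_meas_ge_le_lintegral (μ := P)
    ((hMm n).mono (past_le hZ.measurable _) le_rfl) (ENNReal.ofReal (Real.exp u))
  have hsub : {ω | ‖c ω - w₀‖ ≤ Δ ∧ u ≤ ∑ t ∈ Finset.range n, lam *
      ((1 - 2 / p.ξ) * risk D loss (W t ω) - risk D loss w₀
        - progress p loss Δ w₀ (W t ω) (Z (j + t) ω))}
      ⊆ {ω | ENNReal.ofReal (Real.exp u) ≤ M n ω} := by
    rintro ω ⟨hω, hu⟩
    have hdom : ∀ t, W t ω ∈ domain p.R (2 * Δ) w₀ := fun t => by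
      have hmem := stageIterate_mem (loss := loss) hΔ.le (hc ω) (fun s => Z (j + s) ω) t
      refine ⟨hmem.1, ?_⟩
      calc ‖W t ω - w₀‖ = ‖(W t ω - c ω) + (c ω - w₀)‖ := by rw [sub_add_sub_cancel]
        _ ≤ Δ + Δ := (norm_add_le _ _).trans (add_le_add hmem.2 hω)
        _ = 2 * Δ := by ring
    simp only [Set.mem_ofPred_eq, hM, weight, Set.indicator_of_mem (hdom _)]
    rw [← ENNReal.ofReal_prod_of_nonneg fun _ _ => (Real.exp_pos _).le, ← Real.exp_sum]
    exact ENNReal.ofReal_le_ofReal (Real.exp_le_exp.2 hu)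
  refine (measure_mono hsub).trans ?_
  rw [Real.exp_neg, ENNReal.ofReal_inv_of_pos (Real.exp_pos u)]
  rw [← one_div, ENNReal.le_div_iff_mul_le (Or.inl (by simp [Real.exp_pos]))
    (Or.inl ENNReal.ofReal_ne_top), mul_comm]
  exact hmarkov.trans (hM1 n)

end Sampling

end

section

variable {d : ℕ} {Y : Type*} {loss : ℝ → Y → ℝ}

/-! ### Contraction of the risk over a stage -/

theorem domainSize_succ_sq {p : Params} (hβ : 0 < p.β) (hε : 0 ≤ p.ε) (hτ : 0 ≤ p.τ)
    (he : 0 ≤ p.εprior) (k : ℕ) :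
    domainSize p (k + 1) ^ 2 = p.ε * domainSize p k ^ 2 + 2 * p.τ / p.β * p.εprior :=
  Real.sq_sqrt (by positivity)

theorem domainSize_pos {p : Params} (hR : 0 < p.R) (hβ : 0 < p.β) (hε : 0 < p.ε) (hτ : 0 ≤ p.τ)
    (he : 0 ≤ p.εprior) (k : ℕ) : 0 < domainSize p k := by
  induction k with
  | zero => exact hR
  | succ k ih => exact Real.sqrt_pos.2 (by positivity)

theorem domainSize_sq_le {p : Params} (hβ : 0 < p.β) (hε : 0 ≤ p.ε) (hε1 : p.ε < 1)
    (hτ : 0 ≤ p.τ) (he : 0 ≤ p.εprior) (k : ℕ) :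
    domainSize p k ^ 2 ≤ p.ε ^ k * p.R ^ 2 + 2 * p.τ / p.β * p.εprior / (1 - p.ε) := by
  have h1 : 0 < 1 - p.ε := by linarith
  induction k with
  | zero =>
    have : 0 ≤ 2 * p.τ / p.β * p.εprior / (1 - p.ε) := by positivity
    simpa [domainSize] using this
  | succ k ih =>
    rw [domainSize_succ_sq hβ hε hτ he]
    refine (add_le_add (mul_le_mul_of_nonneg_left ih hε) le_rfl).trans (le_of_eq ?_)
    field_simp
    ring

variable [MeasurableSpace Y]

/-- A stage whose total excess is below `u` contracts the risk gap: regret and confidence term each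
cost `α ε Δ² / 8`, and the discount `2 / ξ` of the risk costs `4 / ξ = α τ / β` times the optimum. -/
theorem risk_stageAverage_sub_le {p : Params} {D : Measure (Vec d × Y)} {α Δ lam u : ℝ}
    (h : Setting D loss α p.β p.R) (hα : 0 < α) (hβ : 0 < p.β)
    (hτ : 0 < p.τ) (hξ : p.ξ = 4 * p.β / (α * p.τ)) (hξ4 : 4 ≤ p.ξ) (hT : 0 < p.T₁)
    (hη : p.η = 1 / (2 * p.ξ * p.β * Real.sqrt p.T₁))
    (hTlow : 8 * p.ξ * p.β ≤ α * p.ε * Real.sqrt p.T₁) (hΔ : 0 < Δ) (hlam0 : 0 < lam)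
    (hlam : u = lam * (α * p.ε * Δ ^ 2 * p.T₁ / 8))
    {w₀ : Vec d} (hw₀ : w₀ ∈ hypotheses d p.R)
    (hmin : ∀ w ∈ hypotheses d p.R, risk D loss w₀ ≤ risk D loss w)
    (hprior : risk D loss w₀ ≤ p.εprior)
    {c : Vec d} (hc : c ∈ hypotheses d p.R) (hcw : ‖c - w₀‖ ≤ Δ) (S : ℕ → Vec d × Y)
    (hexc : ∑ t ∈ Finset.range p.T₁, lam *
        ((1 - 2 / p.ξ) * risk D loss (stageIterate p loss c Δ S t)
          - risk D loss w₀ - progress p loss Δ w₀ (stageIterate p loss c Δ S t) (S t)) < u) :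
    risk D loss (stageAverage p loss c Δ S) - risk D loss w₀
      ≤ α / 2 * (p.ε * Δ ^ 2 + 2 * p.τ / p.β * p.εprior) := by
  have hT' : (0 : ℝ) < p.T₁ := by exact_mod_cast hT
  have hsT : 0 < Real.sqrt p.T₁ := Real.sqrt_pos.2 hT'
  have hsT2 : Real.sqrt p.T₁ ^ 2 = p.T₁ := Real.sq_sqrt hT'.le
  have hξ0 : 0 < p.ξ := by linarith
  have hη0 : 0 < p.η := by rw [hη]; positivity
  have hreg := sum_progress_le (loss := loss) hη0 hΔ.le hc hw₀ hcw S p.T₁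
  have havg := risk_stageAverage_le h hα.le hT hΔ.le hc S
  have hA := hmin _ (stageAverage_mem (loss := loss) hT hΔ.le hc S)
  set A := risk D loss (stageAverage p loss c Δ S)
  set L := risk D loss w₀
  have hL0 : 0 ≤ L := h.risk_nonneg w₀
  rw [← Finset.mul_sum, hlam] at hexc
  have hexc' := lt_of_mul_lt_mul_left hexc hlam0.le
  rw [Finset.sum_sub_distrib, Finset.sum_sub_distrib, ← Finset.mul_sum, Finset.sum_const,
    Finset.card_range, nsmul_eq_mul] at hexc'
  have hreg2 : Δ ^ 2 / (2 * p.η) ≤ α * p.ε * Δ ^ 2 * p.T₁ / 8 := by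
    have e : Δ ^ 2 / (2 * p.η) = Δ ^ 2 * (p.ξ * p.β) * Real.sqrt p.T₁ := by
      rw [hη]; field_simp
    have e2 : α * p.ε * Δ ^ 2 * p.T₁ / 8
        = Δ ^ 2 * (α * p.ε * Real.sqrt p.T₁ / 8) * Real.sqrt p.T₁ := by
      linear_combination (-(α * p.ε * Δ ^ 2 / 8)) * hsT2
    rw [e, e2]
    gcongr
    linarith
  set r := 2 / p.ξ with hr
  have hr0 : 0 < r := by positivity
  have hr1 : r ≤ 1 / 2 := by rw [hr, div_le_iff₀ hξ0]; linarith
  have hr2 : r = α * p.τ / (2 * p.β) := by rw [hr, hξ]; field_simp; ring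
  have h1 : (1 - r) * (p.T₁ * A) - p.T₁ * L ≤ p.T₁ * (α * p.ε * Δ ^ 2 / 4) := by
    have := mul_le_mul_of_nonneg_left havg (by linarith : 0 ≤ 1 - r)
    linarith
  have h2 : (1 - r) * A - L ≤ α * p.ε * Δ ^ 2 / 4 := by
    refine le_of_mul_le_mul_left (le_trans (le_of_eq ?_) h1) hT'
    ring
  have h3 : A - L ≤ α * p.ε * Δ ^ 2 / 2 + 2 * r * L := by nlinarith
  have h4 : r * L ≤ r * p.εprior := mul_le_mul_of_nonneg_left hprior hr0.le
  have h5 : α / 2 * (p.ε * Δ ^ 2 + 2 * p.τ / p.β * p.εprior)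
      = α * p.ε * Δ ^ 2 / 2 + 2 * (r * p.εprior) := by rw [hr2]; field_simp
  rw [h5]; linarith

theorem one_sub_le_measureReal_of_compl {Ω : Type*} [MeasurableSpace Ω] {P : Measure Ω}
    [IsProbabilityMeasure P] {s t : Set Ω} {δ : ℝ} (hst : sᶜ ⊆ t) (hδ : 0 ≤ δ)
    (ht : P t ≤ ENNReal.ofReal δ) : 1 - δ ≤ P.real s := by
  have h1 : P.real Set.univ ≤ P.real s + P.real sᶜ := by
    rw [← Set.union_compl_self s]; exact measureReal_union_le _ _
  have h2 : P.real sᶜ ≤ δ :=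
    ENNReal.toReal_le_of_le_ofReal hδ ((measure_mono hst).trans ht)
  rw [probReal_univ] at h1
  linarith

section Params
variable {m : ℕ} {α β R ε τ εprior δ : ℝ}

theorem one_le_peels : 1 ≤ peels α β R τ εprior := le_max_left _ _

/-- Positivity of the confidence level of a stage: the exponents of the stages are proportional to
it. -/
theorem log_stages_pos (hm : 1 ≤ m) (hδ0 : 0 < δ) (hδ1 : δ < 1) :
    0 < Real.log (m * peels α β R τ εprior / δ) := by
  refine Real.log_pos ?_
  rw [one_lt_div hδ0]
  have h1 : (1 : ℝ) ≤ m := by exact_mod_cast hm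
  have h2 : (1 : ℝ) ≤ peels α β R τ εprior := by exact_mod_cast one_le_peels
  nlinarith

theorem four_le_xi (hα : 0 < α) (hαβ : α ≤ β) (hτ0 : 0 < τ) (hτ1 : τ < 1) : 4 ≤ xi α β τ := by
  rw [xi, le_div_iff₀ (by positivity)]
  nlinarith

theorem le_sqrt_stageSize (hα : 0 < α) (hβ : 0 < β) (hε : 0 < ε) (hτ : 0 < τ) :
    8 * xi α β τ * β ≤ α * ε * Real.sqrt (stageSize d m α β R ε τ εprior δ) := by
  have hξ : 0 < xi α β τ := by unfold xi; positivity
  have h1 : (8 * xi α β τ * β / (α * ε)) ^ 2 ≤ stageSize d m α β R ε τ εprior δ := by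
    refine le_trans ?_ (Nat.le_ceil _)
    refine le_trans (le_of_eq ?_) (mul_le_mul_of_nonneg_left (le_max_right _ _) (by norm_num))
    field_simp; ring
  have h2 := Real.le_sqrt_of_sq_le h1
  rw [div_le_iff₀ (by positivity)] at h2
  linarith

theorem log_le_stageSize (hα : 0 < α) (hε : 0 < ε) :
    4 * (xi α β τ ^ 3 * β * d + 2 * xi α β τ * β * Real.sqrt d)
      * Real.log (m * peels α β R τ εprior / δ)
      ≤ α * ε * stageSize d m α β R ε τ εprior δ := by
  have h1 : 4 * ((xi α β τ ^ 3 * β * d + 2 * xi α β τ * β * Real.sqrt d) / (ε * α)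
      * Real.log (m * peels α β R τ εprior / δ)) ≤ stageSize d m α β R ε τ εprior δ :=
    (mul_le_mul_of_nonneg_left (le_max_left _ _) (by norm_num)).trans (Nat.le_ceil _)
  have h2 := mul_le_mul_of_nonneg_left h1 (by positivity : 0 ≤ α * ε)
  refine le_trans (le_of_eq ?_) h2
  field_simp

end Params

end

/-! ### The risk bound -/

/-- A union bound over the stages. Outside the exceptional events every stage keeps the minimiser
`w₀` within `domainSize` of the next centre: a risk gap of at most `α Δ² / 2` at the output of a
stage means a distance of at most `Δ`, by strong convexity. The same gap at the last stage is the
asserted bound, as `α ≤ β`. -/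
theorem risk_output_le_prob {d m : ℕ} {α β R ε τ εprior δ : ℝ} (hα : 0 < α) (hβ : 0 < β)
    (hR : 0 < R) (hε0 : 0 < ε) (hε1 : ε < 1) (hτ0 : 0 < τ) (hτ1 : τ < 1) (hm : 1 ≤ m)
    (he : 0 < εprior) (hδ0 : 0 < δ) (hδ1 : δ < 1) {Y : Type*} [MeasurableSpace Y]
    {D : Measure (Vec d × Y)} {loss : ℝ → Y → ℝ} (h : Setting D loss α β R)
    (hprior : optRisk D loss R ≤ εprior) {Ω : Type*} [MeasurableSpace Ω] {P : Measure Ω}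
    [IsProbabilityMeasure P] {Z : ℕ → Ω → Vec d × Y} (hZ : IsIIDSample P D Z) :
    1 - δ ≤ P.real {ω | risk D loss (output (params d m α β R ε τ εprior δ) loss
      (fun i => Z i ω) m) ≤ β * R ^ 2 / 2 * ε ^ m + (1 + τ / (1 - ε)) * εprior} := by
  obtain ⟨w₀, hw₀, hopt, hmin⟩ := h.exists_minimizer hβ hR.le
  rw [← hopt] at hprior
  have h1ε : 0 < 1 - ε := by linarith
  rcases Nat.eq_zero_or_pos d with hd0 | hd
  · -- There is only one predictor in dimension zero; here `α ≤ β` may fail.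
    subst hd0
    refine one_sub_le_measureReal_of_compl (t := ∅) (fun ω hω => hω ?_) hδ0.le (by simp)
    change risk D loss _ ≤ _
    rw [Subsingleton.elim (output (params 0 m α β R ε τ εprior δ) loss (fun i => Z i ω) m) w₀]
    have h1 : 0 ≤ β * R ^ 2 / 2 * ε ^ m := by positivity
    have h2 : 0 ≤ τ / (1 - ε) * εprior := by positivity
    linarith
  have hαβ : α ≤ β := h.alpha_le_beta hβ hR hd
  set p := params d m α β R ε τ εprior δ with hp
  set u := Real.log (m * peels α β R τ εprior / δ) with hu
  have hu0 : 0 < u := log_stages_pos hm hδ0 hδ1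
  have hξ4 : 4 ≤ p.ξ := four_le_xi hα hαβ hτ0 hτ1
  have hξ0 : 0 < p.ξ := by linarith
  have hTlow : 8 * p.ξ * β ≤ α * ε * Real.sqrt p.T₁ := le_sqrt_stageSize hα hβ hε0 hτ0
  have hTlog : 4 * (p.ξ ^ 3 * β * d + 2 * p.ξ * β * Real.sqrt d) * u ≤ α * ε * p.T₁ :=
    log_le_stageSize hα hε0
  have hsT32 : 32 ≤ Real.sqrt p.T₁ := by
    have h1 : α * ε ≤ β := by nlinarith
    have h2 : 0 ≤ Real.sqrt p.T₁ := Real.sqrt_nonneg _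
    have h3 : β * 32 ≤ β * Real.sqrt p.T₁ := by nlinarith
    exact le_of_mul_le_mul_left h3 hβ
  have hsT0 : 0 < Real.sqrt p.T₁ := by linarith
  have hT' : (0 : ℝ) < p.T₁ := Real.sqrt_pos.1 hsT0
  have hT : 0 < p.T₁ := by exact_mod_cast hT'
  have hηeq : p.η = 1 / (2 * p.ξ * β * Real.sqrt p.T₁) := rfl
  have hη0 : 0 < p.η := by rw [hηeq]; positivity
  have hη : p.η * (64 * p.ξ * β) ≤ 1 := by
    have e : p.η * (64 * p.ξ * β) = 32 / Real.sqrt p.T₁ := by rw [hηeq]; field_simp; norm_num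
    rw [e, div_le_one hsT0]; exact hsT32
  have hΔ : ∀ k, 0 < domainSize p k := domainSize_pos hR hβ hε0 hτ0.le he.le
  have hΔs : ∀ k, domainSize p (k + 1) ^ 2 = ε * domainSize p k ^ 2 + 2 * τ / β * εprior :=
    domainSize_succ_sq hβ hε0.le hτ0.le he.le
  have hd1 : (1 : ℝ) ≤ Real.sqrt d := by
    rw [Real.one_le_sqrt]; exact_mod_cast hd
  have hd2 : Real.sqrt d * Real.sqrt d = d := Real.mul_self_sqrt (Nat.cast_nonneg d)
  -- The exponent of stage `k` is chosen so that the confidence term `u / lam` costs exactly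
  -- `α ε Δ² T₁ / 8`; the stage size then makes it small enough for the second-order expansion.
  set lam : ℕ → ℝ := fun k => 8 * u / (α * ε * domainSize p k ^ 2 * p.T₁) with hlamdef
  have hlam0 : ∀ k, 0 < lam k := fun k => by have := hΔ k; simp only [hlamdef]; positivity
  have hlamu : ∀ k, u = lam k * (α * ε * domainSize p k ^ 2 * p.T₁ / 8) := fun k => by
    have := hΔ k; simp only [hlamdef]; field_simp
  have hlam1 : ∀ k, lam k * (9 * p.ξ * β * Real.sqrt d * domainSize p k ^ 2) ≤ 1 := fun k => by
    have hk := hΔ k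
    have e : lam k * (9 * p.ξ * β * Real.sqrt d * domainSize p k ^ 2)
        = 72 * (p.ξ * β * Real.sqrt d) * u / (α * ε * p.T₁) := by
      simp only [hlamdef]; field_simp; norm_num
    rw [e, div_le_one (by positivity)]
    refine le_trans (mul_le_mul_of_nonneg_right ?_ hu0.le) hTlog
    have h1 : 16 * Real.sqrt d ≤ p.ξ ^ 2 * d := by
      have : (16 : ℝ) ≤ p.ξ ^ 2 := by nlinarith
      have : Real.sqrt d ≤ d := by nlinarith
      nlinarith
    have h2 := mul_le_mul_of_nonneg_left h1 (by positivity : 0 ≤ p.ξ * β)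
    nlinarith
  have hlam2 : ∀ k, lam k * (β * p.ξ ^ 3 * d * domainSize p k ^ 2) ≤ 2 := fun k => by
    have hk := hΔ k
    have e : lam k * (β * p.ξ ^ 3 * d * domainSize p k ^ 2)
        = 8 * (p.ξ ^ 3 * β * d) * u / (α * ε * p.T₁) := by
      simp only [hlamdef]; field_simp
    rw [e, div_le_iff₀ (by positivity)]
    have h1 : 0 ≤ p.ξ * β * Real.sqrt d * u := by positivity
    linarith
  set c : ℕ → Ω → Vec d := fun k ω => output p loss (fun i => Z i ω) k with hc
  have hcm : ∀ k, Measurable[past Z (k * p.T₁)] (c k) :=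
    measurable_output hT hR.le hΔ h.measurable_loss (fun y => (h.loss_smooth y).1) Z
  have hcH : ∀ k ω, c k ω ∈ hypotheses d R := fun k ω =>
    output_mem hT hR.le (fun k => (hΔ k).le) _ k
  set B : ℕ → Set Ω := fun k => {ω | ‖c k ω - w₀‖ ≤ domainSize p k ∧
    u ≤ ∑ t ∈ Finset.range p.T₁, lam k * ((1 - 2 / p.ξ) * risk D loss
      (stageIterate p loss (c k ω) (domainSize p k) (fun s => Z (k * p.T₁ + s) ω) t)
      - risk D loss w₀ - progress p loss (domainSize p k) w₀
        (stageIterate p loss (c k ω) (domainSize p k) (fun s => Z (k * p.T₁ + s) ω) t)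
        (Z (k * p.T₁ + t) ω))} with hB
  have hBP : ∀ k, P (B k) ≤ ENNReal.ofReal (Real.exp (-u)) := fun k =>
    measure_excess_le h hβ hξ4 hη0 hη hd (hΔ k) (hlam0 k) (hlam1 k) (hlam2 k) hw₀ hZ
      (hcm k) (hcH k) p.T₁ u
  refine one_sub_le_measureReal_of_compl (t := ⋃ k ∈ Finset.range m, B k) ?_ hδ0.le ?_
  · rw [Set.compl_subset_comm]
    intro ω hω
    simp only [Set.mem_compl_iff, Set.mem_iUnion, not_exists] at hω
    have hstage : ∀ k < m, ‖c k ω - w₀‖ ≤ domainSize p k →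
        risk D loss (c (k + 1) ω) - risk D loss w₀ ≤ α / 2 * domainSize p (k + 1) ^ 2 := by
      intro k hk hcw
      have hexc := hω k (Finset.mem_range.2 hk)
      simp only [hB, Set.mem_ofPred_eq, not_and, not_le] at hexc
      rw [hΔs k]
      exact risk_stageAverage_sub_le h hα hβ hτ0 rfl hξ4 hT hηeq hTlow (hΔ k) (hlam0 k)
        (hlamu k) hw₀ hmin hprior (hcH k ω) hcw _ (hexc hcw)
    have hdist : ∀ k ≤ m, ‖c k ω - w₀‖ ≤ domainSize p k := by
      intro k
      induction k with
      | zero =>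
        intro _
        change ‖(0 : Vec d) - w₀‖ ≤ R
        rw [zero_sub, norm_neg]; exact hw₀
      | succ k ih =>
        intro hk
        have h1 := hstage k hk (ih (by omega))
        have h2 := h.sq_norm_sub_le hw₀ hmin (hcH (k + 1) ω)
        refine (sq_le_sq₀ (norm_nonneg _) (hΔ _).le).1 ?_
        exact le_of_mul_le_mul_left (h2.trans h1) (by positivity)
    obtain ⟨k, rfl⟩ : ∃ k, m = k + 1 := ⟨m - 1, by omega⟩
    have h1 := hstage k (by omega) (hdist k (by omega))
    have h2 : domainSize p (k + 1) ^ 2 ≤ ε ^ (k + 1) * R ^ 2 + 2 * τ / β * εprior / (1 - ε) :=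
      domainSize_sq_le hβ hε0.le hε1 hτ0.le he.le (k + 1)
    change risk D loss (c (k + 1) ω) ≤ _
    have h3 : α / 2 * domainSize p (k + 1) ^ 2 ≤ β / 2 * domainSize p (k + 1) ^ 2 := by gcongr
    have h4 := mul_le_mul_of_nonneg_left h2 (by positivity : 0 ≤ β / 2)
    have e : β / 2 * (ε ^ (k + 1) * R ^ 2 + 2 * τ / β * εprior / (1 - ε))
        = β * R ^ 2 / 2 * ε ^ (k + 1) + τ / (1 - ε) * εprior := by field_simp
    linarith
  · calc P (⋃ k ∈ Finset.range m, B k) ≤ ∑ k ∈ Finset.range m, P (B k) :=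
          measure_biUnion_finset_le _ _
      _ ≤ ∑ _k ∈ Finset.range m, ENNReal.ofReal (Real.exp (-u)) :=
          Finset.sum_le_sum fun k _ => hBP k
      _ = ENNReal.ofReal (m * Real.exp (-u)) := by
          rw [Finset.sum_const, Finset.card_range, nsmul_eq_mul,
            ENNReal.ofReal_mul (Nat.cast_nonneg m), ENNReal.ofReal_natCast]
      _ ≤ ENNReal.ofReal δ := by
          refine ENNReal.ofReal_le_ofReal ?_
          have hm0 : (0 : ℝ) < m := by exact_mod_cast hm
          have hs1 : (1 : ℝ) ≤ peels α β R τ εprior := by exact_mod_cast one_le_peels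
          have hs0 : (0 : ℝ) < peels α β R τ εprior := by linarith
          have e : m * Real.exp (-u) = δ / peels α β R τ εprior := by
            rw [Real.exp_neg, hu, Real.exp_log (by positivity)]; field_simp
          rw [e]
          exact div_le_self hδ0.le hs1

/-! ### Sample complexity -/

/-- The number of peels grows at most linearly in `l = log (1 / εprior)`. -/
theorem peels_le {α β R τ εprior : ℝ} (hK : 0 < xi α β τ * β * R ^ 2) (he : 0 < εprior)
    (hl : 1 ≤ Real.log (1 / εprior)) :
    (peels α β R τ εprior : ℝ) ≤
      ((|Real.log (xi α β τ * β * R ^ 2)| + 1) / Real.log 2 + 2) * Real.log (1 / εprior) := by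
  have hl2 : 0 < Real.log 2 := Real.log_pos one_lt_two
  set K := xi α β τ * β * R ^ 2
  set l := Real.log (1 / εprior) with hldef
  set q := Real.logb 2 (K / εprior) with hq
  have hqle : q ≤ (|Real.log K| + 1) / Real.log 2 * l := by
    rw [hq, Real.logb, div_mul_eq_mul_div]
    refine div_le_div_of_nonneg_right ?_ hl2.le
    have e : K / εprior = K * (1 / εprior) := by ring
    rw [e, Real.log_mul hK.ne' (by positivity)]
    nlinarith [le_abs_self (Real.log K), abs_nonneg (Real.log K)]
  have h0 : 0 ≤ (|Real.log K| + 1) / Real.log 2 * l := by positivity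
  have h1 : (⌈q⌉₊ : ℝ) ≤ (|Real.log K| + 1) / Real.log 2 * l + 1 :=
    (Nat.cast_le.2 (Nat.ceil_mono hqle)).trans (Nat.ceil_lt_add_one h0).le
  rw [peels, Nat.cast_max, Nat.cast_one]
  exact max_le (by linarith) (h1.trans (by linarith))

/-- If the number `N` of events in the union bound is at most `A l²`, its contribution to the
confidence term is absorbed in `log (l / δ)`. -/
theorem log_div_le_of_le_mul_sq {A l δ N : ℝ} (hA : 0 < A) (hl : 2 ≤ l) (hδ0 : 0 < δ)
    (hδ1 : δ ≤ 1) (hN0 : 0 < N) (hN : N ≤ A * l ^ 2) :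
    Real.log (N / δ) ≤ (|Real.log A| / Real.log 2 + 2) * Real.log (l / δ) := by
  have hl2 : 0 < Real.log 2 := Real.log_pos one_lt_two
  have hl0 : 0 < l := by linarith
  have h1 : Real.log (N / δ) ≤ Real.log (A * (l / δ) ^ 2) := by
    refine Real.log_le_log (by positivity) ?_
    calc N / δ ≤ A * l ^ 2 / δ := by gcongr
      _ ≤ A * l ^ 2 / (δ * δ) := by
          refine div_le_div_of_nonneg_left (by positivity) (by positivity) ?_
          nlinarith
      _ = A * (l / δ) ^ 2 := by field_simp
  rw [Real.log_mul (by positivity) (by positivity), Real.log_pow] at h1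
  have hΛ : Real.log 2 ≤ Real.log (l / δ) :=
    Real.log_le_log two_pos (by rw [le_div_iff₀ hδ0]; nlinarith)
  have h2 : |Real.log A| ≤ |Real.log A| / Real.log 2 * Real.log (l / δ) := by
    rw [div_mul_eq_mul_div, le_div_iff₀ hl2]
    exact mul_le_mul_of_nonneg_left hΛ (abs_nonneg _)
  have h3 := le_abs_self (Real.log A)
  push_cast at h1
  linarith

theorem stageSize_le {d m : ℕ} {α β R ε τ εprior δ A Λ : ℝ} (hα : 0 < α) (hβ : 0 < β)
    (hε : 0 < ε) (hξ : 0 < xi α β τ) (hd : 1 ≤ d) (hΛ : Real.log 2 ≤ Λ)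
    (hu0 : 0 ≤ Real.log (m * peels α β R τ εprior / δ))
    (hu : Real.log (m * peels α β R τ εprior / δ) ≤ A * Λ) :
    (stageSize d m α β R ε τ εprior δ : ℝ) ≤
      (4 * ((xi α β τ ^ 3 * β + 2 * xi α β τ * β) / (ε * α) * A
        + 16 * xi α β τ ^ 2 * β ^ 2 / (α ^ 2 * ε ^ 2) / Real.log 2) + 1 / Real.log 2) * (d * Λ) := by
  have hl2 : 0 < Real.log 2 := Real.log_pos one_lt_two
  have hd' : (1 : ℝ) ≤ d := by exact_mod_cast hd
  have hΛ0 : 0 < Λ := by linarith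
  have hone : 1 ≤ d * Λ / Real.log 2 := by rw [le_div_iff₀ hl2]; nlinarith
  unfold stageSize
  set ξ := xi α β τ
  set u := Real.log (m * peels α β R τ εprior / δ)
  set B := 16 * ξ ^ 2 * β ^ 2 / (α ^ 2 * ε ^ 2) with hB
  have hB0 : 0 < B := by positivity
  set a := (ξ ^ 3 * β * d + 2 * ξ * β * Real.sqrt d) / (ε * α) * u with ha
  have h1 : a ≤ (ξ ^ 3 * β + 2 * ξ * β) / (ε * α) * A * (d * Λ) := by
    have hsd : Real.sqrt d ≤ d := Real.sqrt_le_iff.2 ⟨by linarith, by nlinarith⟩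
    calc a ≤ (ξ ^ 3 * β * d + 2 * ξ * β * d) / (ε * α) * (A * Λ) := by
          rw [ha]; gcongr
      _ = (ξ ^ 3 * β + 2 * ξ * β) / (ε * α) * A * (d * Λ) := by ring
  have h2 : B ≤ B / Real.log 2 * (d * Λ) := by
    calc B = B * 1 := (mul_one _).symm
      _ ≤ B * (d * Λ / Real.log 2) := mul_le_mul_of_nonneg_left hone hB0.le
      _ = B / Real.log 2 * (d * Λ) := by ring
  have ha0 : 0 ≤ a := by positivity
  have h3 : max a B ≤ a + B := max_le_add_of_nonneg ha0 hB0.le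
  have h4 : (⌈4 * max a B⌉₊ : ℝ) ≤ 4 * max a B + 1 := (Nat.ceil_lt_add_one (by positivity)).le
  have e : 1 / Real.log 2 * (d * Λ) = d * Λ / Real.log 2 := by ring
  rw [add_mul, e, mul_assoc, add_mul]
  linarith

/-- The number of stages is `⌈log (1 / εprior) / log (1 / ε)⌉`, the first that makes
`ε ^ m ≤ εprior`. With `l = log (1 / εprior)`, the numbers of stages and of peels are both `O(l)`, so
that `log (m s / δ)` is `O(log (l / δ))`. -/
theorem exists_stages_mul_stageSize_le {α β R ε τ : ℝ} (hα : 0 < α) (hβ : 0 < β) (hR : 0 < R)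
    (hε0 : 0 < ε) (hε1 : ε < 1) (hτ0 : 0 < τ) :
    ∃ C : ℝ, 0 < C ∧ ∀ (d : ℕ) (εprior δ : ℝ),
      1 ≤ d → 0 < εprior → εprior ≤ 1 / 16 → 0 < δ → δ < 1 →
      ∃ m : ℕ, 1 ≤ m ∧ ε ^ m ≤ εprior ∧
        ((m * stageSize d m α β R ε τ εprior δ : ℕ) : ℝ)
          ≤ C * (d * Real.log (1 / εprior) * Real.log (Real.log (1 / εprior) / δ)) := by
  have hξ0 : 0 < xi α β τ := by rw [xi]; positivity
  have hb : 0 < Real.log (1 / ε) := Real.log_pos (by rw [one_lt_div hε0]; exact hε1)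
  set b := Real.log (1 / ε) with hbdef
  have hl2 : 0 < Real.log 2 := Real.log_pos one_lt_two
  set A₁ := 1 / b + 1 with hA₁
  have hA₁0 : 0 < A₁ := by positivity
  obtain ⟨A₂, hA₂0, hA₂⟩ : ∃ A₂ : ℝ, 0 < A₂ ∧ ∀ εprior : ℝ, 0 < εprior →
      1 ≤ Real.log (1 / εprior) → (peels α β R τ εprior : ℝ) ≤ A₂ * Real.log (1 / εprior) :=
    ⟨_, by positivity, fun _ he hl => peels_le (by positivity) he hl⟩
  obtain ⟨A₃, hA₃0, hA₃⟩ : ∃ A₃ : ℝ, 0 < A₃ ∧ ∀ l δ N : ℝ, 2 ≤ l → 0 < δ → δ ≤ 1 → 0 < N →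
      N ≤ A₁ * A₂ * l ^ 2 → Real.log (N / δ) ≤ A₃ * Real.log (l / δ) :=
    ⟨_, by positivity, fun _ _ _ => log_div_le_of_le_mul_sq (by positivity)⟩
  obtain ⟨C₁, hC₁0, hC₁⟩ : ∃ C₁ : ℝ, 0 < C₁ ∧ ∀ (d m : ℕ) (εprior δ Λ : ℝ), 1 ≤ d →
      Real.log 2 ≤ Λ → 0 ≤ Real.log (m * peels α β R τ εprior / δ) →
      Real.log (m * peels α β R τ εprior / δ) ≤ A₃ * Λ →
      (stageSize d m α β R ε τ εprior δ : ℝ) ≤ C₁ * (d * Λ) :=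
    ⟨_, by positivity, fun _ _ _ _ _ hd => stageSize_le hα hβ hε0 hξ0 hd⟩
  refine ⟨A₁ * C₁, by positivity, fun d εprior δ hd he he16 hδ0 hδ1 => ?_⟩
  set l := Real.log (1 / εprior) with hl
  have hl1 : 2 ≤ l := by
    have h1 : Real.log 16 ≤ l := by
      refine Real.log_le_log (by norm_num) ?_
      rw [le_div_iff₀ he]; linarith
    have h2 : Real.log 16 = 4 * Real.log 2 := by
      rw [show (16 : ℝ) = 2 ^ 4 by norm_num, Real.log_pow]; norm_num
    linarith [Real.log_two_gt_d9]
  have hl0 : 0 < l := by linarith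
  have hΛ2 : Real.log 2 ≤ Real.log (l / δ) :=
    Real.log_le_log two_pos (by rw [le_div_iff₀ hδ0]; nlinarith)
  set m := ⌈l / b⌉₊ with hmdef
  have hm1 : 1 ≤ m := Nat.one_le_ceil_iff.2 (by positivity)
  have hm0 : (0 : ℝ) < m := by exact_mod_cast hm1
  have hmle : (m : ℝ) ≤ A₁ * l := by
    refine (Nat.ceil_lt_add_one (by positivity : 0 ≤ l / b)).le.trans ?_
    rw [hA₁, add_mul, one_div_mul_eq_div]; linarith
  refine ⟨m, hm1, ?_, ?_⟩
  · have h1 : l ≤ m * b := by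
      have := Nat.le_ceil (l / b)
      rwa [div_le_iff₀ hb] at this
    rw [hl, hbdef, one_div, one_div, Real.log_inv, Real.log_inv] at h1
    rw [← Real.log_le_log_iff (by positivity) he, Real.log_pow]
    linarith
  have hs1 : (1 : ℝ) ≤ peels α β R τ εprior := by exact_mod_cast one_le_peels
  have hN : (m : ℝ) * peels α β R τ εprior ≤ A₁ * A₂ * l ^ 2 := by
    calc (m : ℝ) * peels α β R τ εprior ≤ (A₁ * l) * (A₂ * l) :=
          mul_le_mul hmle (hA₂ εprior he (by linarith)) (by linarith) (by positivity)
      _ = A₁ * A₂ * l ^ 2 := by ring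
  have hT := hC₁ d m εprior δ _ hd hΛ2 (log_stages_pos hm1 hδ0 hδ1).le
    (hA₃ l δ _ hl1 hδ0 hδ1.le (mul_pos hm0 (by linarith)) hN)
  rw [Nat.cast_mul]
  calc (m : ℝ) * stageSize d m α β R ε τ εprior δ
      ≤ (A₁ * l) * (C₁ * (d * Real.log (l / δ))) :=
        mul_le_mul hmle hT (Nat.cast_nonneg _) (by positivity)
    _ = A₁ * C₁ * (d * l * Real.log (l / δ)) := by ring

end TargetRisk

theorem theorem2 (α β R ε τ : ℝ) (hα : 0 < α) (hβ : 0 < β) (hR : 0 < R)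
    (hε0 : 0 < ε) (hε1 : ε < 1) (hτ0 : 0 < τ) (hτ1 : τ < 1) :
    -- the risk bound after `m` stages
    (∀ (d m : ℕ) (εprior δ : ℝ), 1 ≤ m → 0 < εprior → 0 < δ → δ < 1 →
      ∀ (Y : Type*) [MeasurableSpace Y] (D : Measure (TargetRisk.Vec d × Y)) (loss : ℝ → Y → ℝ),
      TargetRisk.Setting D loss α β R → TargetRisk.optRisk D loss R ≤ εprior →
      ∀ (Ω : Type*) [MeasurableSpace Ω] (P : Measure Ω) [IsProbabilityMeasure P]
        (Z : ℕ → Ω → TargetRisk.Vec d × Y), TargetRisk.IsIIDSample P D Z →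
      1 - δ ≤ P.real {ω |
        TargetRisk.risk D loss
            (TargetRisk.output (TargetRisk.params d m α β R ε τ εprior δ) loss (fun i => Z i ω) m)
          ≤ β * R ^ 2 / 2 * ε ^ m + (1 + τ / (1 - ε)) * εprior}) ∧
    -- the resulting sample complexity
    (∃ C : ℝ, 0 < C ∧ ∀ (d : ℕ) (εprior δ : ℝ),
      1 ≤ d → 0 < εprior → εprior ≤ 1 / 16 → 0 < δ → δ < 1 →
      ∃ m : ℕ, 1 ≤ m ∧
        ((m * TargetRisk.stageSize d m α β R ε τ εprior δ : ℕ) : ℝ)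
          ≤ C * (d * Real.log (1 / εprior) * Real.log (Real.log (1 / εprior) / δ)) ∧
        ∀ (Y : Type*) [MeasurableSpace Y] (D : Measure (TargetRisk.Vec d × Y))
          (loss : ℝ → Y → ℝ),
        TargetRisk.Setting D loss α β R → TargetRisk.optRisk D loss R ≤ εprior →
        ∀ (Ω : Type*) [MeasurableSpace Ω] (P : Measure Ω) [IsProbabilityMeasure P]
          (Z : ℕ → Ω → TargetRisk.Vec d × Y), TargetRisk.IsIIDSample P D Z →
        1 - δ ≤ P.real {ω |
          TargetRisk.risk D loss
              (TargetRisk.output (TargetRisk.params d m α β R ε τ εprior δ) loss (fun i => Z i ω) m)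
            ≤ (1 + τ / (1 - ε) + β * R ^ 2 / 2) * εprior}) := by 
  refine ⟨fun d m εprior δ hm he hδ0 hδ1 Y _ D loss h hprior Ω _ P _ Z hZ =>
    TargetRisk.risk_output_le_prob hα hβ hR hε0 hε1 hτ0 hτ1 hm he hδ0 hδ1 h hprior hZ, ?_⟩
  obtain ⟨C, hC, hsize⟩ :=
    TargetRisk.exists_stages_mul_stageSize_le hα hβ hR hε0 hε1 hτ0
  refine ⟨C, hC, fun d εprior δ hd he he16 hδ0 hδ1 => ?_⟩
  obtain ⟨m, hm, hpow, hle⟩ := hsize d εprior δ hd he he16 hδ0 hδ1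
  refine ⟨m, hm, hle, fun Y _ D loss h hprior Ω _ P _ Z hZ => ?_⟩
  have hbound : β * R ^ 2 / 2 * ε ^ m + (1 + τ / (1 - ε)) * εprior
      ≤ (1 + τ / (1 - ε) + β * R ^ 2 / 2) * εprior := by
    have := mul_le_mul_of_nonneg_left hpow (by positivity : 0 ≤ β * R ^ 2 / 2)
    linarith
  refine (TargetRisk.risk_output_le_prob hα hβ hR hε0 hε1 hτ0 hτ1 hm he hδ0 hδ1 h hprior hZ).trans
    (measureReal_mono fun ω hω => ?_)
  simp only [Set.mem_ofPred_eq] at hω ⊢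
  exact hω.trans hbound
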